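/- Let $n=k^2$ with $k\ge 1$, and divide the $n\times n$ array into $k^2$ blocks of size $k\times k$ in the usual way. A partial Sudoku square of order $n$ is an $n\times n$ array, each of whose cells is empty or contains an element of $\{1,\dots,n\}$, such that every element appears at most once in each row, in each column and in each block; it is a Sudoku square if no cell is empty. For $0\le m<n$, an $m\times n$ Sudoku rectangle is a partial Sudoku square of order $n$ in which precisely the cells of the first $m$ rows are filled. A completion of it is a Sudoku square of order $n$ that agrees with it on the filled cells. (a) There is a polynomial-time algorithm which, given an $m\times n$ Sudoku rectangle $R$ (for arbitrary $n=k^2$ and $m<n$), finds a completion of $R$ to a Sudoku square, or decides that $R$ has no such completion. (That is, one program for a random access machine with addition and subtraction as its arithmetic operations, unit costs, and as input $n$ and the $n^2$ cells of $R$, halts within $p(n)$ steps with a correct answer, where $p$ is a fixed polynomial.) (b) Write $m=lk+r$ with $0\le l<k$ and $0\le r<k$. For each $d\in\{1,\dots,k\}$ let $G_d$ be the following bipartite graph: its column vertices are the $k$ columns of the block $B_d$ with coordinates $(l+1,d)$; its element vertices are the elements of $\{1,\dots,n\}$ that do not appear in the $r$ filled rows of $B_d$; a column is adjacent to an element if the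 element does not appear in that column of $R$. Then $R$ has a completion to a Sudoku square if and only if, for every $d\in\{1,\dots,k\}$, the graph $G_d$ has a perfect $1$-to-$(k-r)$ matching, that is, a set of edges that contains precisely $k-r$ edges at each column vertex and precisely one edge at each element vertex. -/

import Mathlib

/-! ### Sudoku squares and rectangles

Rows, columns and symbols are indexed by `Fin n`, that is by `0, …, n - 1`; an empty cell is `none`.
-/

/-- An `n × n` array with entries from the `n` symbols, some of whose cells may be empty. -/
abbrev PartialGrid (n : ℕ) : Type := Fin n → Fin n → Option (Fin n)

/-- An `n × n` array all of whose cells are filled. -/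
abbrev FullGrid (n : ℕ) : Type := Fin n → Fin n → Fin n

/-- Every symbol appears at most once in each row. -/
def RowCondition {n : ℕ} (P : PartialGrid n) : Prop :=
  ∀ i j j' x, P i j = some x → P i j' = some x → j = j'

/-- Every symbol appears at most once in each column. -/
def ColumnCondition {n : ℕ} (P : PartialGrid n) : Prop :=
  ∀ i i' j x, P i j = some x → P i' j = some x → i = i'

/-- Every symbol appears at most once in each `k × k` block; the cell in row `i` and column `j` lies
in the block with coordinates `(i / k, j / k)`. Used with `n = k ^ 2`. -/
def BlockCondition (k : ℕ) {n : ℕ} (P : PartialGrid n) : Prop :=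
  ∀ i j i' j' x, i.val / k = i'.val / k → j.val / k = j'.val / k →
    P i j = some x → P i' j' = some x → i = i' ∧ j = j'

/-- A partial Sudoku square of order `n = k ^ 2`. -/
def IsPartialSudoku (k : ℕ) {n : ℕ} (P : PartialGrid n) : Prop :=
  RowCondition P ∧ ColumnCondition P ∧ BlockCondition k P

/-- An `m × n` Sudoku rectangle (for `m < n`): a partial Sudoku square in which exactly the cells of
the first `m` rows are filled. -/
def IsSudokuRectangle (k m : ℕ) {n : ℕ} (R : PartialGrid n) : Prop :=
  IsPartialSudoku k R ∧ ∀ i j, R i j ≠ none ↔ i.val < m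

/-- A full array, seen as a partial one. -/
def FullGrid.toPartial {n : ℕ} (S : FullGrid n) : PartialGrid n := fun i j => some (S i j)

/-- A Sudoku square of order `n = k ^ 2`. -/
def IsSudokuSquare (k : ℕ) {n : ℕ} (S : FullGrid n) : Prop := IsPartialSudoku k S.toPartial

/-- `P₂` agrees with `P₁` on all filled cells of `P₁`. -/
def Extends {n : ℕ} (P₂ P₁ : PartialGrid n) : Prop := ∀ i j, P₁ i j ≠ none → P₁ i j = P₂ i j

/-- `S` is a Sudoku square that extends `R`. -/
def IsCompletion (k : ℕ) {n : ℕ} (R : PartialGrid n) (S : FullGrid n) : Prop :=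
  IsSudokuSquare k S ∧ Extends S.toPartial R

/-! ### The first-stage graphs

Let `R` be an `m × n` Sudoku rectangle with `m = l * k + r`, `l < k`, `r < k`. For the block with
coordinates `(l, d)` (counted from `0`) there is a bipartite graph with the following vertex classes
and adjacency relation. -/

/-- The column vertices: the `k` columns of the block. -/
def ColumnVertex (k n : ℕ) (d : Fin k) : Type := {j : Fin n // j.val / k = d.val}

/-- The element vertices: the symbols that do not appear in the filled cells of the block. -/
def ElementVertex (k l : ℕ) {n : ℕ} (R : PartialGrid n) (d : Fin k) : Type :=
  {x : Fin n // ∀ i j, i.val / k = l → j.val / k = d.val → R i j ≠ some x}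

/-- A column and a symbol are adjacent if the symbol does not appear in that column of `R`. -/
def FirstStageAdj (k l : ℕ) {n : ℕ} (R : PartialGrid n) (d : Fin k)
    (j : ColumnVertex k n d) (x : ElementVertex k l R d) : Prop :=
  ∀ i, R i j.val ≠ some x.val

/-- The bipartite graph with classes `A`, `B` and adjacency `adj` has a perfect `1`-to-`q` matching:
a set `M` of edges such that every vertex of `A` is incident with precisely `q` edges of `M` and every
vertex of `B` with precisely one. -/
def HasPerfectMatchingOneTo (q : ℕ) {A B : Type} (adj : A → B → Prop) : Prop :=
  ∃ M : A → B → Prop, (∀ a b, M a b → adj a b) ∧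
    (∀ a, {b | M a b}.Finite ∧ {b | M a b}.ncard = q) ∧ ∀ b, ∃! a, M a b

/-! ### Random access machines

Programs for a random access machine whose memory consists of registers and arrays of natural
numbers. A program mentions only finitely many registers and arrays, by fixed names; arrays are
addressed indirectly. The arithmetic operations are addition and truncated subtraction, and there is
no multiplication, so that every number arising in `t` steps has `O(t + b)` bits if the input words have
at most `b` bits: with unit costs, polynomial time on this machine is polynomial time on
Turing machines. -/

namespace RAM

/-- Arithmetic expressions. `load a e` is the content of array `a` at the address `e`. -/
inductive Expr : Type
  | const (c : ℕ)
  | reg (x : ℕ)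
  | load (a : ℕ) (e : Expr)
  | add (e₁ e₂ : Expr)
  | sub (e₁ e₂ : Expr)

/-- Programs. The tests of `cond` and `loop` are whether the expression is nonzero. -/
inductive Prog : Type
  | skip
  | assign (x : ℕ) (e : Expr)
  | store (a : ℕ) (addr e : Expr)
  | seq (p q : Prog)
  | cond (e : Expr) (p q : Prog)
  | loop (e : Expr) (p : Prog)

/-- The content of the memory. -/
structure State : Type where
  reg : ℕ → ℕ
  arr : ℕ → ℕ → ℕ

/-- The value of an expression. -/
def Expr.eval (s : State) : Expr → ℕ
  | const c => c
  | reg x => s.reg x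
  | load a e => s.arr a (e.eval s)
  | add e₁ e₂ => e₁.eval s + e₂.eval s
  | sub e₁ e₂ => e₁.eval s - e₂.eval s

/-- The number of steps for evaluating an expression: one for each constant, register access, array
access and arithmetic operation. -/
def Expr.cost : Expr → ℕ
  | const _ => 1
  | reg _ => 1
  | load _ e => e.cost + 1
  | add e₁ e₂ => e₁.cost + e₂.cost + 1
  | sub e₁ e₂ => e₁.cost + e₂.cost + 1

/-- Write `v` into the register `x`. -/
def State.setReg (s : State) (x v : ℕ) : State :=
  { s with reg := Function.update s.reg x v }

/-- Write `v` into the array `a` at the address `i`. -/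
def State.setArr (s : State) (a i v : ℕ) : State :=
  { s with arr := Function.update s.arr a (Function.update (s.arr a) i v) }

/-- `Exec p s t s'`: started in the memory state `s`, the program `p` halts after precisely `t` steps
in the memory state `s'`. -/
inductive Exec : Prog → State → ℕ → State → Prop
  | skip (s : State) : Exec .skip s 1 s
  | assign (s : State) (x : ℕ) (e : Expr) :
      Exec (.assign x e) s (e.cost + 1) (s.setReg x (e.eval s))
  | store (s : State) (a : ℕ) (addr e : Expr) :
      Exec (.store a addr e) s (addr.cost + e.cost + 1) (s.setArr a (addr.eval s) (e.eval s))
  | seq {p q : Prog} {s₀ s₁ s₂ : State} {t₁ t₂ : ℕ} :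
      Exec p s₀ t₁ s₁ → Exec q s₁ t₂ s₂ → Exec (.seq p q) s₀ (t₁ + t₂) s₂
  | cond_true {e : Expr} {p q : Prog} {s s' : State} {t : ℕ} :
      e.eval s ≠ 0 → Exec p s t s' → Exec (.cond e p q) s (e.cost + 1 + t) s'
  | cond_false {e : Expr} {p q : Prog} {s s' : State} {t : ℕ} :
      e.eval s = 0 → Exec q s t s' → Exec (.cond e p q) s (e.cost + 1 + t) s'
  | loop_true {e : Expr} {p : Prog} {s s₁ s₂ : State} {t₁ t₂ : ℕ} :
      e.eval s ≠ 0 → Exec p s t₁ s₁ → Exec (.loop e p) s₁ t₂ s₂ →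
        Exec (.loop e p) s (e.cost + 1 + t₁ + t₂) s₂
  | loop_false {e : Expr} {p : Prog} {s : State} :
      e.eval s = 0 → Exec (.loop e p) s (e.cost + 1) s

/-- The initial memory state: the input words stand in array `0` from the address `0` on, their number
in register `0`, and everything else is `0`. -/
def inputState (w : List ℕ) : State where
  reg x := if x = 0 then w.length else 0
  arr a i := if a = 0 then w.getD i 0 else 0

/-- The output of a final memory state: the words in array `1` from the address `0` on, their number
being given by register `1`. -/
def output (s : State) : List ℕ := (List.range (s.reg 1)).map (s.arr 1)

/-- On the input `w`, the program `p` halts after precisely `t` steps with the output `v`. -/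
def Run (p : Prog) (w : List ℕ) (t : ℕ) (v : List ℕ) : Prop :=
  ∃ s', Exec p (inputState w) t s' ∧ output s' = v

end RAM

/-! ### Encoding of inputs and outputs -/

/-- An empty cell is written as `0`, the symbol number `x` (counted from `0`) as `x + 1`. -/
def cellCode {n : ℕ} : Option (Fin n) → ℕ
  | none => 0
  | some x => x.val + 1

/-- The `n * n` cells, row by row. -/
def gridWords {n : ℕ} (P : PartialGrid n) : List ℕ :=
  List.ofFn fun c : Fin (n * n) => cellCode (P c.divNat c.modNat)

/-- The input: the order, followed by the cells row by row. -/
def inputWords {n : ℕ} (P : PartialGrid n) : List ℕ := n :: gridWords P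

/-- The answer: `0` for "there is no completion", and `1` followed by the cells row by row for a
completion. -/
def answerWords {n : ℕ} : Option (FullGrid n) → List ℕ
  | none => [0]
  | some S => 1 :: gridWords S.toPartial

/-- A correct answer for the rectangle `R`: a completion of `R`, or, if there is none, `none`. -/
def IsCorrectAnswer (k : ℕ) {n : ℕ} (R : PartialGrid n) : Option (FullGrid n) → Prop
  | none => ¬ ∃ S : FullGrid n, IsCompletion k R S
  | some S => IsCompletion k R S

/-! ### Matchings in bipartite graphs -/

/-! If rows are ignored, the blocks of a band are independent: filling one of them can conflict only
with its own columns. A completion fills every block of the band with index `l`. Conversely, it is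
enough that these `k` blocks can be filled, each filled cell keeping its symbol and each empty cell
receiving one that is new to its column.

After such a filling, rows of the band may still repeat symbols. They are repaired one at a time by
exchanging cells inside columns, which respects columns and blocks. When the rows before `p` are
done and the band ends before row `q`, each column still holds `q - p` symbols from row `p` on, and
each symbol is still available in at most `q - p` columns. Hall's theorem then supplies the next row
(`IsDraft.exists_row`). Below `b` complete bands a block can always be filled: a cell admits at
least `k * (k - b)` symbols, and a symbol fits at most that many cells
(`IsDraft.exists_isBlockFilling`). Both uses of Hall's theorem go through
`exists_injective_of_degree_le`. Hence only the partially filled band, or the first empty one if `r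
= 0`, can obstruct a completion. Distributing the `k - r` symbols matched to a column over its `k -
r` empty cells turns first-stage matchings into block fillings, which gives (b).

For (a), the same proof is executed. Each decision is a perfect matching problem on `n + n`
vertices: cells against symbols for a block, columns against symbols for a row. It is solved by an
auction: an unmatched vertex takes over its cheapest neighbour and raises its price by one. If a
perfect matching exists, prices never exceed `n` (`IsAuction.exists_cheap`), so `n ^ 2 + 1` bids
suffice. All loops have exactly `n` passes, so polynomial time follows by induction on the program
(`RAM.Cmd.exec_toProg`). A block can fail only in a band that starts no later than row `m`, where
the working array is still `R`; the failure therefore refutes every completion. -/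

open Finset in
/-- There is a matching that covers the left side if all degrees on the left are at least `D`, and all degrees on the right
at most `D`. -/
theorem exists_injective_of_degree_le {α β : Type} [Fintype α] [Fintype β] (adj : α → β → Prop)
    [∀ a b, Decidable (adj a b)] {D : ℕ} (hD : 0 < D) (hleft : ∀ a, D ≤ #{b | adj a b}) (hright : ∀ b, #{a | adj a b} ≤ D) :
    ∃ f : α → β, Function.Injective f ∧ ∀ a, adj a (f a) := by
  rw [← Fintype.all_card_le_filter_rel_iff_exists_injective]
  intro A
  -- Double counting of the edges between `A` and its neighbourhood yields Hall's condition after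
  -- cancelling `D`.
  have key : #A * D ≤ #{b | ∃ a ∈ A, adj a b} * D := by
    refine card_mul_le_card_mul adj (fun a ha => (hleft a).trans (card_le_card ?_))
      fun b _ => (card_le_card ?_).trans (hright b)
    · intro b hb
      simp only [mem_filter, mem_univ, true_and] at hb
      simp only [mem_bipartiteAbove, mem_filter, mem_univ, true_and]
      exact ⟨⟨a, ha, hb⟩, hb⟩
    · intro a ha
      simp only [mem_bipartiteBelow] at ha
      simpa using ha.2
  exact Nat.le_of_mul_le_mul_right key hD

/-! ### The auction algorithm for perfect matchings -/

/-- The bipartite graph with the adjacency relation `adj` has a matching that covers the left side. -/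
def HasMatching {α : Type} (adj : α → α → Prop) : Prop :=
  ∃ σ : α → α, Function.Injective σ ∧ ∀ u, adj u (σ u)

/-- The invariant of the auction algorithm: `mate` is a matching, a left vertex is matched to a right
vertex whose price exceeds the price of no neighbour by more than one, and only matched right vertices
have a positive price. -/
structure IsAuction {α : Type} (adj : α → α → Prop) (mate : α → Option α) (price : α → ℕ) : Prop where
  inj : ∀ u u' v, mate u = some v → mate u' = some v → u = u'
  adj_of_mate : ∀ u v, mate u = some v → adj u v
  slack : ∀ u v w, mate u = some v → adj u w → price v ≤ price w + 1
  owned : ∀ v, price v ≠ 0 → ∃ u, mate u = some v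

namespace IsAuction

variable {α : Type} {adj : α → α → Prop} {mate : α → Option α} {price : α → ℕ}

theorem empty (adj : α → α → Prop) : IsAuction adj (fun _ => none) (fun _ => 0) :=
  ⟨by simp, by simp, by simp, by simp⟩

open Finset in
open Classical in
/-- If the graph has a perfect matching, then every unmatched vertex has a cheap neighbour. -/
theorem exists_cheap [Fintype α] (h : IsAuction adj mate price) (hm : HasMatching adj) {x : α}
    (hx : mate x = none) : ∃ w, adj x w ∧ price w < Fintype.card α := by
  by_contra! hcon
  obtain ⟨σ, hσ, hadj⟩ := hm
  -- The owners of the vertices of price at least `t + 1`, together with `x`, are sent by `σ` to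
  -- vertices of price at least `t`: for owners by `slack`, for `x` by the assumption to be refuted.
  -- So the number of vertices above a price level drops at each of `n + 1` levels, although there
  -- are only `n` vertices.
  have step : ∀ t, t ≤ Fintype.card α → #{v | t + 1 ≤ price v} + 1 ≤ #{v | t ≤ price v} := by
    intro t ht
    have hown : ∀ v : α, ∃ u, t + 1 ≤ price v → mate u = some v := fun v => by
      by_cases hv : t + 1 ≤ price v
      · obtain ⟨u, hu⟩ := h.owned v (by omega)
        exact ⟨u, fun _ => hu⟩
      · exact ⟨v, fun h => absurd h hv⟩
    choose o ho using hown
    have hnot : x ∉ ({v | t + 1 ≤ price v} : Finset α).image o := by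
      simp only [mem_image, mem_filter, mem_univ, true_and, not_exists, not_and]
      intro v hv hvx
      have := ho v hv
      rw [hvx, hx] at this
      cases this
    have hcard : #(({v | t + 1 ≤ price v} : Finset α).image o) = #{v | t + 1 ≤ price v} := by
      refine card_image_of_injOn fun v hv v' hv' hvv => ?_
      simp only [coe_filter, mem_univ, true_and, Set.mem_ofPred_eq] at hv hv'
      have h1 := ho v hv
      rw [hvv, ho v' hv'] at h1
      exact (Option.some.inj h1).symm
    rw [← hcard, ← card_insert_of_notMem hnot, ← card_image_of_injective _ hσ]
    refine card_le_card fun w hw => ?_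
    simp only [mem_image, mem_insert, mem_filter, mem_univ, true_and] at hw ⊢
    obtain ⟨u, rfl | ⟨v, hv, rfl⟩, rfl⟩ := hw
    · exact ht.trans (hcon _ (hadj _))
    · have := h.slack _ _ _ (ho v hv) (hadj _)
      omega
  have all : ∀ t, t ≤ Fintype.card α + 1 → #{v | t ≤ price v} + t ≤ Fintype.card α := by
    intro t
    induction t with
    | zero => intro _; simp [card_univ]
    | succ t ih =>
      intro ht
      have := ih (by omega)
      have := step t (by omega)
      omega
  have := all _ le_rfl
  omega

/-- The unmatched vertex `x` takes over its cheapest neighbour `y`. -/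
theorem bid [DecidableEq α] (h : IsAuction adj mate price) {x y : α} (hx : mate x = none)
    (hxy : adj x y) (hmin : ∀ w, adj x w → price y ≤ price w) :
    IsAuction adj (fun u => if u = x then some y else if mate u = some y then none else mate u)
      (Function.update price y (price y + 1)) where
  inj u u' v hu hu' := by
    by_cases h1 : u = x <;> by_cases h2 : u' = x <;> by_cases h3 : mate u = some y <;>
      by_cases h4 : mate u' = some y <;> simp_all
    exact h.inj u u' v hu hu'
  adj_of_mate u v hu := by
    by_cases h1 : u = x <;> by_cases h3 : mate u = some y <;> simp_all
    exact h.adj_of_mate u v hu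
  slack u v w hu huw := by
    -- Prices only rise, so the right-hand side of an old slack inequality can only improve. The one
    -- price that rises belongs to `y`, whose new owner `x` chose it as cheapest and whose former
    -- owner is released.
    have hle : price w ≤ Function.update price y (price y + 1) w := by
      by_cases hw : w = y
      · subst hw; simp
      · simp [hw]
    by_cases h1 : u = x
    · simp only [h1, if_true, Option.some.injEq] at hu
      subst hu h1
      have := hmin w huw
      simp only [Function.update_self]
      omega
    · by_cases h3 : mate u = some y
      · simp [h1, h3] at hu
      · simp only [h1, h3, if_false] at hu
        have hvy : v ≠ y := fun hv => h3 (hv ▸ hu)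
        have := h.slack u v w hu huw
        rw [Function.update_of_ne hvy]
        omega
  owned v hv := by
    by_cases hvy : v = y
    · exact ⟨x, by simp [hvy]⟩
    · rw [Function.update_of_ne hvy] at hv
      obtain ⟨u, hu⟩ := h.owned v hv
      refine ⟨u, ?_⟩
      have h1 : u ≠ x := by rintro rfl; simp [hx] at hu
      simp [h1, hu, hvy]

end IsAuction

/-- After `T` bids of the auction algorithm, if the graph has a perfect matching: the prices are bounded,
and all left vertices are matched unless all bids have raised a price. -/
def AuctionProgress {α : Type} [Fintype α] (adj : α → α → Prop) (mate : α → Option α) (price : α → ℕ)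
    (T : ℕ) : Prop :=
  HasMatching adj → (∀ v, price v ≤ Fintype.card α) ∧ ((∀ u, mate u ≠ none) ∨ ∑ v, price v = T)

/-- A bid raises the total price by exactly one. The price raised is below `n` beforehand, because
it is at most that of the cheap neighbour from `exists_cheap`. The new matching plays no role here
and is left arbitrary. -/
theorem AuctionProgress.bid {α : Type} [Fintype α] [DecidableEq α] {adj : α → α → Prop}
    {mate : α → Option α} {price : α → ℕ} {T : ℕ} (h : IsAuction adj mate price)
    (hT : AuctionProgress adj mate price T) {x y : α} (hx : mate x = none)
    (hmin : ∀ w, adj x w → price y ≤ price w) (mate' : α → Option α) :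
    AuctionProgress adj mate' (Function.update price y (price y + 1)) (T + 1) := by
  intro hm
  obtain ⟨h1, h2⟩ := hT hm
  have hsum : ∑ v, price v = T := h2.resolve_left fun hu => hu x hx
  constructor
  · intro v
    by_cases hv : v = y
    · subst hv
      obtain ⟨w, hw, hlt⟩ := h.exists_cheap hm hx
      have := hmin w hw
      simp only [Function.update_self]
      omega
    · rw [Function.update_of_ne hv]
      exact h1 v
  · right
    rw [Finset.sum_update_of_mem (Finset.mem_univ y), ← hsum,
      ← Finset.add_sum_erase Finset.univ price (Finset.mem_univ y), Finset.sdiff_singleton_eq_erase]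
    omega

/-- There are no more than `n ^ 2` bids if the graph has a perfect matching. -/
theorem AuctionProgress.all_matched {α : Type} [Fintype α] {adj : α → α → Prop}
    {mate : α → Option α} {price : α → ℕ} {T : ℕ} (hT : AuctionProgress adj mate price T)
    (hlt : Fintype.card α * Fintype.card α < T) (hm : HasMatching adj) (u : α) : mate u ≠ none := by
  obtain ⟨h1, h2⟩ := hT hm
  refine h2.elim (fun h => h u) fun h => ?_
  have : ∑ v, price v ≤ ∑ _v : α, Fintype.card α := Finset.sum_le_sum fun v _ => h1 v
  simp only [Finset.sum_const, Finset.card_univ, smul_eq_mul] at this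
  omega

/-! ### Filling a Sudoku rectangle -/

/-- The index with quotient `b` and remainder `a` modulo `k`. -/
def blockIndex {k n : ℕ} (hn : n = k ^ 2) (b a : Fin k) : Fin n :=
  ⟨b.val * k + a.val, by
    have h1 := b.isLt
    have h2 := a.isLt
    have : (b.val + 1) * k ≤ k * k := Nat.mul_le_mul_right k h1
    rw [hn, sq]
    linarith⟩

section blockIndex

variable {k n : ℕ} (hn : n = k ^ 2)

theorem blockIndex_div (b a : Fin k) : (blockIndex hn b a).val / k = b.val := by
  have hk : 0 < k := b.pos
  simp only [blockIndex]
  rw [mul_comm, Nat.mul_add_div hk, Nat.div_eq_of_lt a.isLt, add_zero]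

theorem blockIndex_mod (b a : Fin k) : (blockIndex hn b a).val % k = a.val := by
  simp only [blockIndex]
  rw [mul_comm, Nat.mul_add_mod, Nat.mod_eq_of_lt a.isLt]

theorem blockIndex_inj {b a b' a' : Fin k} (h : blockIndex hn b a = blockIndex hn b' a') :
    b = b' ∧ a = a' := by
  constructor
  · rw [Fin.ext_iff, ← blockIndex_div hn b a, h, blockIndex_div]
  · rw [Fin.ext_iff, ← blockIndex_mod hn b a, h, blockIndex_mod]

theorem exists_blockIndex (i : Fin n) : ∃ b a : Fin k, b.val = i.val / k ∧ a.val = i.val % k ∧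
    i = blockIndex hn b a := by
  have hi := i.isLt
  have hk : 0 < k := by
    rcases Nat.eq_zero_or_pos k with rfl | h
    · simp [hn] at hi
    · exact h
  refine ⟨⟨i.val / k, ?_⟩, ⟨i.val % k, Nat.mod_lt _ hk⟩, rfl, rfl, ?_⟩
  · rw [Nat.div_lt_iff_lt_mul hk, ← sq, ← hn]
    exact hi
  · rw [Fin.ext_iff]
    simp only [blockIndex]
    exact (Nat.div_add_mod' _ _).symm

end blockIndex

/-! ### Arranging the rows of a filled band -/

/-- The cells of the first `q` rows are filled, and all conditions hold, except that symbols may appear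
repeatedly in the rows from row `p` on. -/
structure IsDraft (k p q : ℕ) {n : ℕ} (P : PartialGrid n) : Prop where
  column : ColumnCondition P
  block : BlockCondition k P
  row : ∀ i j j' x, i.val < p → P i j = some x → P i j' = some x → j = j'
  filled : ∀ i j, P i j ≠ none ↔ i.val < q

theorem IsSudokuRectangle.isDraft {k m n : ℕ} {R : PartialGrid n} (h : IsSudokuRectangle k m R) :
    IsDraft k m m R :=
  ⟨h.1.2.1, h.1.2.2, fun i j j' x _ => h.1.1 i j j' x, h.2⟩

namespace IsDraft

variable {k p q n : ℕ} {P : PartialGrid n}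

theorem exists_eq_some (h : IsDraft k p q P) {i : Fin n} (hi : i.val < q) (j : Fin n) :
    ∃ x, P i j = some x :=
  Option.ne_none_iff_exists'.1 ((h.filled i j).2 hi)

theorem lt_of_eq_some (h : IsDraft k p q P) {i j x : Fin n} (hx : P i j = some x) : i.val < q :=
  (h.filled i j).1 (by simp [hx])

/-- A complete row contains every symbol. -/
theorem exists_in_row (h : IsDraft k p q P) (hpq : p ≤ q) {i : Fin n} (hi : i.val < p) (x : Fin n) :
    ∃ j, P i j = some x := by
  choose f hf using h.exists_eq_some (hi.trans_le hpq)
  have hinj : Function.Injective f := fun j j' hjj =>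
    h.row i j j' (f j) hi (hf j) (by rw [hjj]; exact hf j')
  obtain ⟨j, rfl⟩ := Finite.surjective_of_injective hinj x
  exact ⟨j, hf j⟩

/-- A complete block contains every symbol. -/
theorem exists_in_block (h : IsDraft k p q P) (hn : n = k ^ 2) {b : ℕ} (hb : (b + 1) * k ≤ q)
    (hbk : b < k) {d : ℕ} (hd : d < k) (x : Fin n) :
    ∃ i j, i.val / k = b ∧ j.val / k = d ∧ P i j = some x := by
  have hfill : ∀ c : Fin k × Fin k, ∃ x, P (blockIndex hn ⟨b, hbk⟩ c.1) (blockIndex hn ⟨d, hd⟩ c.2)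
      = some x := fun c => h.exists_eq_some (by
    have := c.1.isLt
    simp only [blockIndex]
    linarith) _
  choose f hf using hfill
  have hinj : Function.Injective f := fun c c' hcc => by
    have := h.block _ _ _ _ (f c) (by rw [blockIndex_div, blockIndex_div])
      (by rw [blockIndex_div, blockIndex_div]) (hf c) ((hf c').trans (by rw [hcc]))
    exact Prod.ext (blockIndex_inj hn this.1).2 (blockIndex_inj hn this.2).2
  have hbij : Function.Bijective f := by
    rw [Fintype.bijective_iff_injective_and_card]
    exact ⟨hinj, by simp [hn, sq]⟩
  obtain ⟨c, rfl⟩ := hbij.2 x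
  exact ⟨_, _, blockIndex_div _ _ _, blockIndex_div _ _ _, hf c⟩

open Classical in
/-- A row of the last band that has not been arranged yet can be arranged by exchanging cells
within the columns. -/
theorem exists_row (h : IsDraft k p q P) (hn : n = k ^ 2) {b : ℕ} (hq : q = (b + 1) * k)
    (hb : b < k) (hbp : b * k ≤ p) (hpq : p < q) :
    HasMatching fun j x : Fin n => ∃ i, p ≤ i.val ∧ P i j = some x := by
  have hk : 0 < k := by omega
  have hqn : q ≤ n := by
    rw [hq, hn, sq]
    exact Nat.mul_le_mul_right k hb
  refine exists_injective_of_degree_le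
    (fun j x : Fin n => ∃ i : Fin n, p ≤ i.val ∧ P i j = some x) (D := q - p) (by omega) (fun j => ?_) fun x => ?_
  -- Degree of a column: its entries in the rows from `p` to `q - 1` are distinct.
  · have hfill : ∀ t : Fin (q - p), ∃ x, P ⟨p + t.val, by omega⟩ j = some x := fun t =>
      h.exists_eq_some (by simp only; omega) j
    choose f hf using hfill
    have hinj : Function.Injective f := fun t t' htt => by
      have := h.column _ _ j (f t) (hf t) (by rw [htt]; exact hf t')
      simp only [Fin.mk.injEq, add_right_inj] at this
      exact Fin.ext this
    rw [← Fintype.card_fin (q - p), ← Finset.card_univ, ← Finset.card_image_of_injective _ hinj]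
    refine Finset.card_le_card fun y hy => ?_
    simp only [Finset.mem_image, Finset.mem_univ, true_and, Finset.mem_filter] at hy ⊢
    obtain ⟨t, rfl⟩ := hy
    exact ⟨_, by simp, hf t⟩
  · rw [← Fintype.card_subtype (fun j => ∃ i : Fin n, p ≤ i.val ∧ P i j = some x)]
    have hrow : ∀ t : Fin (p - b * k), ∃ j, P ⟨b * k + t.val, by omega⟩ j = some x := fun t =>
      h.exists_in_row hpq.le (by simp only; omega) x
    choose g hg using hrow
    -- Occurrences of `x` in the band: one for each column that still offers `x`, and one for each
    -- of the `p - b * k` arranged rows. They lie in different blocks of the band, so there are at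
    -- most `k`; this leaves at most `k - (p - b * k) = q - p` columns.
    let cell : {j : Fin n // ∃ i, p ≤ i.val ∧ P i j = some x} ⊕ Fin (p - b * k) → Fin n × Fin n :=
      Sum.elim (fun j => (j.2.choose, j.1)) fun t => (⟨b * k + t.val, by omega⟩, g t)
    have hcell : ∀ c, P (cell c).1 (cell c).2 = some x := by
      rintro (j | t)
      · exact j.2.choose_spec.2
      · exact hg t
    have hband : ∀ c, (cell c).1.val / k = b := fun c => by
      have h1 := h.lt_of_eq_some (hcell c)
      have h2 : b * k ≤ (cell c).1.val := by
        rcases c with j | t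
        · exact hbp.trans j.2.choose_spec.1
        · exact Nat.le_add_right _ _
      exact Nat.div_eq_of_lt_le h2 (hq ▸ h1)
    have hinj : Function.Injective cell := by
      rintro (j | t) (j' | t') hcc
      · exact congrArg Sum.inl (Subtype.ext (congrArg Prod.snd hcc))
      · have h1 : p ≤ _ := j.2.choose_spec.1
        have h2 := congrArg (fun c => c.1.val) hcc
        simp only [cell, Sum.elim_inl, Sum.elim_inr] at h2
        omega
      · have h1 : p ≤ _ := j'.2.choose_spec.1
        have h2 := congrArg (fun c => c.1.val) hcc
        simp only [cell, Sum.elim_inl, Sum.elim_inr] at h2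
        omega
      · have h2 := congrArg (fun c => c.1.val) hcc
        simp only [cell, Sum.elim_inr] at h2
        exact congrArg Sum.inr (Fin.ext (by omega))
    let stack : {j : Fin n // ∃ i, p ≤ i.val ∧ P i j = some x} ⊕ Fin (p - b * k) → Fin k :=
      fun c => ⟨(cell c).2.val / k, by
        rw [Nat.div_lt_iff_lt_mul hk, ← sq, ← hn]
        exact (cell c).2.isLt⟩
    have hstack : Function.Injective stack := fun c c' hcc => by
      have := h.block _ _ _ _ x ((hband c).trans (hband c').symm) (congrArg Fin.val hcc) (hcell c)
        (hcell c')
      exact hinj (Prod.ext this.1 this.2)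
    have := Fintype.card_le_of_injective _ hstack
    simp only [Fintype.card_sum, Fintype.card_fin] at this
    have h3 : q = b * k + k := by rw [hq]; ring
    omega

/-- In each column `j`, exchange the cells in the rows `i` and `ι j`. -/
def _root_.exchange {n : ℕ} (P : PartialGrid n) (i : Fin n) (ι : Fin n → Fin n) : PartialGrid n :=
  fun i' j => P (Equiv.swap i (ι j) i') j

theorem exchange_of_lt {i : Fin n} {ι : Fin n → Fin n} (hι : ∀ j, i.val ≤ (ι j).val) {i' : Fin n}
    (hi' : i'.val < i.val) (j : Fin n) : exchange P i ι i' j = P i' j := by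
  rw [exchange, Equiv.swap_apply_of_ne_of_ne]
  · rintro rfl; omega
  · rintro rfl; have := hι j; omega

/-- Each column is permuted inside one band, so the column and block conditions survive. Row `i`
receives the values of the injective `σ`, and earlier rows are untouched because `i ≤ ι j`. -/
theorem isDraft_exchange {i : Fin n} (h : IsDraft k i.val q P) {b : ℕ} (hq : q = (b + 1) * k)
    (hbi : b * k ≤ i.val) {σ ι : Fin n → Fin n} (hσ : Function.Injective σ)
    (hι : ∀ j, i.val ≤ (ι j).val ∧ P (ι j) j = some (σ j)) :
    IsDraft k (i.val + 1) q (exchange P i ι) := by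
  have hlt : ∀ j, (ι j).val < q := fun j => h.lt_of_eq_some (hι j).2
  have hswap : ∀ i' j, (Equiv.swap i (ι j) i').val / k = i'.val / k := fun i' j => by
    have h2 : (ι j).val / k = b := Nat.div_eq_of_lt_le (hbi.trans (hι j).1) (hq ▸ hlt j)
    have h1 : i.val / k = b := Nat.div_eq_of_lt_le hbi (hq ▸ (hι j).1.trans_lt (hlt j))
    rcases eq_or_ne i' i with rfl | hi
    · rw [Equiv.swap_apply_left, h1, h2]
    rcases eq_or_ne i' (ι j) with rfl | hi2
    · rw [Equiv.swap_apply_right, h1, h2]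
    rw [Equiv.swap_apply_of_ne_of_ne hi hi2]
  have hrow : ∀ j, exchange P i ι i j = some (σ j) := fun j => by
    rw [exchange, Equiv.swap_apply_left, (hι j).2]
  refine ⟨fun i₁ i₂ j x h1 h2 => ?_, fun i₁ j₁ i₂ j₂ x hi hj h1 h2 => ?_,
    fun i' j j' x hi' h1 h2 => ?_, fun i' j => ?_⟩
  · exact (Equiv.swap i (ι j)).injective (h.column _ _ j x h1 h2)
  · obtain ⟨h3, rfl⟩ := h.block _ _ _ _ x ((hswap i₁ j₁).trans (hi.trans (hswap i₂ j₂).symm)) hj h1 h2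
    exact ⟨(Equiv.swap i (ι j₁)).injective h3, rfl⟩
  · rcases Nat.lt_succ_iff_lt_or_eq.1 hi' with hlt' | heq
    · rw [exchange_of_lt (fun j => (hι j).1) hlt'] at h1 h2
      exact h.row i' j j' x hlt' h1 h2
    · obtain rfl : i' = i := Fin.ext heq
      rw [hrow] at h1 h2
      exact hσ (Option.some.inj (h1.trans h2.symm))
  · rw [exchange, h.filled]
    have h1 := hι j
    have h2 := hlt j
    rcases eq_or_ne i' i with rfl | hi
    · rw [Equiv.swap_apply_left]; omega
    rcases eq_or_ne i' (ι j) with rfl | hi2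
    · rw [Equiv.swap_apply_right]; omega
    rw [Equiv.swap_apply_of_ne_of_ne hi hi2]

/-- All rows of the last band can be arranged. -/
theorem exists_arranged (hn : n = k ^ 2) {b : ℕ} (hq : q = (b + 1) * k)
    (hb : b < k) : ∀ (t : ℕ) {p : ℕ} {P : PartialGrid n}, IsDraft k p q P → b * k ≤ p → q = p + t →
      ∃ P' : PartialGrid n, IsDraft k q q P' ∧ ∀ i j, i.val < p → P i j = P' i j := by
  intro t
  induction t with
  | zero =>
    intro p P h _ hqp
    obtain rfl : q = p := hqp
    exact ⟨P, h, fun _ _ _ => rfl⟩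
  | succ t ih =>
    intro p P h hbp hqp
    have hqn : q ≤ n := by
      rw [hq, hn, sq]
      exact Nat.mul_le_mul_right k hb
    obtain ⟨σ, hσ, hadj⟩ := h.exists_row hn hq hb hbp (by omega)
    choose ι hι using hadj
    lift p to Fin n using by omega
    obtain ⟨P', hP', hagree⟩ := ih (isDraft_exchange h hq hbp hσ hι) (by omega) (by omega)
    refine ⟨P', hP', fun i j hi => ?_⟩
    rw [← hagree i j (by omega), exchange_of_lt (fun j => (hι j).1) hi]

end IsDraft

/-! ### Filling blocks and bands -/

/-- The symbol `x` stands in the cell, or the cell is empty and `x` does not appear in its column. -/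
def Fits {n : ℕ} (P : PartialGrid n) (i j x : Fin n) : Prop :=
  P i j = some x ∨ P i j = none ∧ ∀ i', P i' j ≠ some x

/-- `τ` fills the block with coordinates `(b, d)`. -/
def IsBlockFilling (k b d : ℕ) {n : ℕ} (P : PartialGrid n) (τ : Fin n → Fin n → Fin n) : Prop :=
  (∀ i j, i.val / k = b → j.val / k = d → Fits P i j (τ i j)) ∧
    ∀ i j i₂ j₂, i.val / k = b → j.val / k = d → i₂.val / k = b → j₂.val / k = d →
      τ i j = τ i₂ j₂ → i = i₂ ∧ j = j₂

/-- Write `τ` into the block with coordinates `(b, d)`. -/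
def fillBlock (k b d : ℕ) {n : ℕ} (P : PartialGrid n) (τ : Fin n → Fin n → Fin n) : PartialGrid n :=
  fun i j => if i.val / k = b ∧ j.val / k = d then some (τ i j) else P i j

/-- `P'` arises from `P` by filling the blocks with coordinates `(b, d)` for `d < D`. -/
structure IsBandFilling (k b D : ℕ) {n : ℕ} (P P' : PartialGrid n) : Prop where
  fits : ∀ i j, i.val / k = b → j.val / k < D → ∃ x, P' i j = some x ∧ Fits P i j x
  inj : ∀ i j i' j' x, i.val / k = b → i'.val / k = b → j.val / k < D → j.val / k = j'.val / k →
    P' i j = some x → P' i' j' = some x → i = i' ∧ j = j'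
  agree : ∀ i j, ¬ (i.val / k = b ∧ j.val / k < D) → P' i j = P i j

namespace IsBandFilling

variable {k b D n : ℕ} {P P' : PartialGrid n}

theorem refl (k b : ℕ) (P : PartialGrid n) : IsBandFilling k b 0 P P :=
  ⟨by simp, by simp, by simp⟩

/-- The next block can be filled after the first blocks have been filled if it can be filled before. -/
theorem isBlockFilling_iff (h : IsBandFilling k b D P P') {τ : Fin n → Fin n → Fin n} :
    IsBlockFilling k b D P' τ ↔ IsBlockFilling k b D P τ := by
  -- Whether a symbol fits depends on one column only, and the blocks filled so far share no column
  -- with the next one.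
  have hagree : ∀ i j, j.val / k = D → P' i j = P i j := fun i j hj => h.agree i j (by omega)
  unfold IsBlockFilling
  refine and_congr_left' (forall₄_congr fun i j _ hj => ?_)
  simp only [Fits, hagree _ j hj]

theorem fillBlock (h : IsBandFilling k b D P P') {τ : Fin n → Fin n → Fin n}
    (hτ : IsBlockFilling k b D P' τ) : IsBandFilling k b (D + 1) P (fillBlock k b D P' τ) := by
  rw [h.isBlockFilling_iff] at hτ
  refine ⟨fun i j hi hj => ?_, fun i j i' j' x hi hi' hj hjj h1 h2 => ?_, fun i j hij => ?_⟩
  · by_cases hjD : j.val / k = D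
    · exact ⟨τ i j, by simp [_root_.fillBlock, hi, hjD], hτ.1 i j hi hjD⟩
    · simpa [_root_.fillBlock, hi, hjD] using h.fits i j hi (by omega)
  · by_cases hjD : j.val / k = D
    · have hjD' : j'.val / k = D := by omega
      simp only [_root_.fillBlock, hi, hi', hjD, hjD', and_self, if_true] at h1 h2
      exact hτ.2 i j i' j' hi hjD hi' hjD' (Option.some.inj (h1.trans h2.symm))
    · have hjD' : ¬ j'.val / k = D := by omega
      simp only [_root_.fillBlock, hjD, hjD', and_false, if_false] at h1 h2
      exact h.inj i j i' j' x hi hi' (by omega) hjj h1 h2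
  · have : ¬ (i.val / k = b ∧ j.val / k = D) := by omega
    simp only [_root_.fillBlock, this, if_false]
    exact h.agree i j (by omega)

/-- A conflict in a column between the band and the rest of the array is excluded by `Fits`; the
rows before `q` are preserved cell by cell, so they stay free of repetitions. The maximum also
covers bands that lie entirely in the filled part, which the algorithm processes in the same way. -/
theorem isDraft (h : IsBandFilling k b k P P') (hn : n = k ^ 2) {q : ℕ} (hP : IsDraft k q q P)
    (hbq : b * k ≤ q) :
    IsDraft k q (max q ((b + 1) * k)) P' ∧ Extends P' P := by
  have hstack : ∀ j : Fin n, j.val / k < k := fun j => by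
    obtain ⟨d, _, hd, _⟩ := exists_blockIndex hn j
    rw [← hd]; exact d.isLt
  have hext : ∀ i j, P i j ≠ none → P i j = P' i j := fun i j hij => by
    by_cases hi : i.val / k = b
    · obtain ⟨x, hx, hfit⟩ := h.fits i j hi (hstack j)
      rcases hfit with hfit | hfit
      · rw [hx, hfit]
      · exact absurd hfit.1 hij
    · exact (h.agree i j (by simp [hi])).symm
  have hout : ∀ i j, i.val / k ≠ b → P' i j = P i j := fun i j hi => h.agree i j (by simp [hi])
  have hmix : ∀ i i' j x, i.val / k = b → i'.val / k ≠ b → P' i j = some x → P' i' j = some x →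
      i = i' := fun i i' j x hi hi' h1 h2 => by
    obtain ⟨y, hy, hfit⟩ := h.fits i j hi (hstack j)
    obtain rfl : y = x := Option.some.inj (hy.symm.trans h1)
    rw [hout i' j hi'] at h2
    rcases hfit with hfit | hfit
    · exact hP.column i i' j y hfit h2
    · exact absurd h2 (hfit.2 i')
  refine ⟨⟨fun i i' j x h1 h2 => ?_, fun i j i' j' x hi hj h1 h2 => ?_,
    fun i j j' x hi h1 h2 => ?_, fun i j => ?_⟩, hext⟩
  · by_cases hi : i.val / k = b <;> by_cases hi' : i'.val / k = b
    · exact (h.inj i j i' j x hi hi' (hstack j) rfl h1 h2).1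
    · exact hmix i i' j x hi hi' h1 h2
    · exact (hmix i' i j x hi' hi h2 h1).symm
    · rw [hout _ _ hi] at h1
      rw [hout _ _ hi'] at h2
      exact hP.column i i' j x h1 h2
  · by_cases hib : i.val / k = b
    · exact h.inj i j i' j' x hib (hi ▸ hib) (hstack j) hj h1 h2
    · rw [hout _ _ hib] at h1
      rw [hout _ _ (hi ▸ hib)] at h2
      exact hP.block i j i' j' x hi hj h1 h2
  · rw [← hext i j ((hP.filled i j).2 hi)] at h1
    rw [← hext i j' ((hP.filled i j').2 hi)] at h2
    exact hP.row i j j' x hi h1 h2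
  · by_cases hi : i.val / k = b
    · obtain ⟨x, hx, _⟩ := h.fits i j hi (hstack j)
      have hk : 0 < k := (Nat.zero_le _).trans_lt (hstack j)
      have h3 := Nat.lt_mul_of_div_lt (Nat.lt_succ_of_le hi.le) hk
      simp only [hx, ne_eq, reduceCtorEq, not_false_eq_true, true_iff]
      exact lt_of_lt_of_le h3 (le_max_right _ _)
    · rw [hout i j hi, hP.filled, lt_max_iff]
      refine ⟨Or.inl, fun h3 => h3.elim id fun h3 => ?_⟩
      by_contra hiq
      exact hi (Nat.div_eq_of_lt_le (by omega) h3)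

/-- If all blocks of a band can be filled, then the band can be filled. -/
theorem exists_of_blocks : ∀ D, (∀ d < D, ∃ τ, IsBlockFilling k b d P τ) →
    ∃ P', IsBandFilling k b D P P' := by
  intro D
  induction D with
  | zero => exact fun _ => ⟨P, refl k b P⟩
  | succ D ih =>
    intro h
    obtain ⟨P', hP'⟩ := ih fun d hd => h d (by omega)
    obtain ⟨τ, hτ⟩ := h D (by omega)
    exact ⟨_, hP'.fillBlock (hP'.isBlockFilling_iff.2 hτ)⟩

end IsBandFilling

/-! ### Completing the remaining bands -/

open Classical in
/-- Every block of the next band can be filled if the filled part consists of complete bands. -/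
theorem IsDraft.exists_isBlockFilling {k b n : ℕ} {P : PartialGrid n} (hn : n = k ^ 2) (hb : b < k)
    (h : IsDraft k (b * k) (b * k) P) {d : ℕ} (hd : d < k) : ∃ τ, IsBlockFilling k b d P τ := by
  have hk : 0 < k := by omega
  have hbn : b * k ≤ n := by rw [hn, sq]; exact Nat.mul_le_mul_right k hb.le
  have hmul : n = k * (k - b) + b * k := by
    obtain ⟨c, rfl⟩ := Nat.exists_eq_add_of_lt hb
    rw [hn, show b + c + 1 - b = c + 1 by omega]; ring
  obtain ⟨σ, hσ, hadj⟩ := exists_injective_of_degree_le (D := k * (k - b))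
    (fun (c : Fin k × Fin k) (x : Fin n) => ∀ i, P i (blockIndex hn ⟨d, hd⟩ c.2) ≠ some x)
    (Nat.mul_pos hk (by omega)) (fun c => by
      -- The column of the cell `c` contains `b * k` distinct symbols, which leaves `n - b * k = k *
      -- (k - b)`.
      have hfill : ∀ t : Fin (b * k), ∃ x, P ⟨t.val, by omega⟩ (blockIndex hn ⟨d, hd⟩ c.2) = some x :=
        fun t => h.exists_eq_some t.isLt _
      choose f hf using hfill
      have hinj : Function.Injective f := fun t t' htt => by
        have := h.column _ _ _ (f t) (hf t) (by rw [htt]; exact hf t')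
        exact Fin.ext (Fin.mk.inj this)
      have h1 : (Finset.univ.image f).card = b * k := by
        rw [Finset.card_image_of_injective _ hinj, Finset.card_univ, Fintype.card_fin]
      have h2 := Finset.card_compl_add_card (Finset.univ.image f)
      rw [h1, Fintype.card_fin] at h2
      refine le_trans (by omega) (Finset.card_le_card (s := (Finset.univ.image f)ᶜ) fun x hx => ?_)
      simp only [Finset.mem_compl, Finset.mem_image, Finset.mem_univ, true_and, not_exists,
        Finset.mem_filter] at hx ⊢
      intro i hi
      refine hx ⟨i.val, h.lt_of_eq_some hi⟩ (Option.some.inj ((hf _).symm.trans hi)))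
    -- Whether `x` fits depends only on the column of the cell. In each of the `b` complete blocks
    -- above, `x` occurs once, and these occurrences use `b` different columns; so at most `k - b`
    -- columns with `k` cells each remain.
    (fun x => by
      refine (Finset.card_le_card (t := Finset.univ ×ˢ
        ({c | ∀ i, P i (blockIndex hn ⟨d, hd⟩ c) ≠ some x} : Finset (Fin k)))
        fun c hc => by simpa using hc).trans ?_
      rw [Finset.card_product, Finset.card_univ, Fintype.card_fin]
      refine Nat.mul_le_mul_left k ?_
      rw [← Fintype.card_subtype]
      have hblk : ∀ t : Fin b, ∃ (i : Fin n) (c : Fin k), i.val / k = t.val ∧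
          P i (blockIndex hn ⟨d, hd⟩ c) = some x := fun t => by
        obtain ⟨i, j, hi, hj, hij⟩ := h.exists_in_block hn (b := t.val)
          (Nat.mul_le_mul_right k t.isLt) (t.isLt.trans hb) hd x
        obtain ⟨d', c, hd', _, rfl⟩ := exists_blockIndex hn j
        obtain rfl : d' = ⟨d, hd⟩ := Fin.ext (hd'.trans hj)
        exact ⟨i, c, hi, hij⟩
      choose i c hi hc using hblk
      have hinj : Function.Injective (Sum.elim Subtype.val c :
          {c // ∀ i, P i (blockIndex hn ⟨d, hd⟩ c) ≠ some x} ⊕ Fin b → Fin k) := by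
        refine Function.Injective.sumElim Subtype.val_injective (fun t t' htt => ?_) fun a t hat => ?_
        · have := h.column _ _ _ x (hc t) (by rw [htt]; exact hc t')
          exact Fin.ext ((hi t).symm.trans ((congrArg (fun i => i.val / k) this).trans (hi t')))
        · exact a.2 _ (hat ▸ hc t)
      have := Fintype.card_le_of_injective _ hinj
      simp only [Fintype.card_sum, Fintype.card_fin] at this
      omega)
  have hmod : ∀ (e : Fin k) (i : Fin n), i.val / k = e.val →
      i = blockIndex hn e ⟨i.val % k, Nat.mod_lt _ hk⟩ := fun e i hi => by
    obtain ⟨b', a, hb', ha, hia⟩ := exists_blockIndex hn i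
    obtain rfl : b' = e := Fin.ext (hb'.trans hi)
    rwa [show (⟨i.val % k, Nat.mod_lt _ hk⟩ : Fin k) = a from Fin.ext ha.symm]
  refine ⟨fun i j => σ (⟨i.val % k, Nat.mod_lt _ hk⟩, ⟨j.val % k, Nat.mod_lt _ hk⟩),
    fun i j hi hj => Or.inr ⟨?_, ?_⟩, fun i j i' j' hi hj hi' hj' hij => ?_⟩
  · by_contra hne
    have h1 : i.val < b * k := (h.filled i j).1 hne
    have h2 := Nat.div_lt_of_lt_mul (mul_comm b k ▸ h1)
    omega
  · have := hadj (⟨i.val % k, Nat.mod_lt _ hk⟩, ⟨j.val % k, Nat.mod_lt _ hk⟩)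
    rwa [← hmod ⟨d, hd⟩ j hj] at this
  · have := hσ hij
    rw [Prod.mk.injEq] at this
    rw [hmod ⟨b, hb⟩ i hi, hmod ⟨b, hb⟩ i' hi', hmod ⟨d, hd⟩ j hj, hmod ⟨d, hd⟩ j' hj',
      this.1, this.2]
    exact ⟨rfl, rfl⟩

/-- A rectangle that consists of complete bands can be completed. -/
theorem IsDraft.exists_isCompletion {k n : ℕ} (hn : n = k ^ 2) : ∀ (t b : ℕ) {P : PartialGrid n},
    k = b + t → IsDraft k (b * k) (b * k) P → ∃ S : FullGrid n, IsCompletion k P S := by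
  intro t
  induction t with
  | zero =>
    intro b P hbk h
    have hlt : ∀ i : Fin n, i.val < b * k := fun i => by
      have := i.isLt
      have h2 : n = b * k := by rw [hn, sq]; rw [← show k = b from hbk]
      omega
    choose S hS using fun i j => h.exists_eq_some (hlt i) j
    have hSP : FullGrid.toPartial S = P := funext fun i => funext fun j => (hS i j).symm
    refine ⟨S, ?_, fun i j _ => ?_⟩
    · rw [IsSudokuSquare, hSP]
      exact ⟨fun i j j' x => h.row i j j' x (hlt i), h.column, h.block⟩
    · rw [hSP]
  | succ t ih =>
    intro b P hbk h
    obtain ⟨P₁, hP₁⟩ := IsBandFilling.exists_of_blocks k fun d hd =>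
      h.exists_isBlockFilling hn (by omega) hd
    obtain ⟨hd₁, hext₁⟩ := hP₁.isDraft hn h le_rfl
    have hle : b * k ≤ (b + 1) * k := Nat.mul_le_mul_right k (by omega)
    rw [max_eq_right hle] at hd₁
    obtain ⟨P₂, hd₂, hagree⟩ := IsDraft.exists_arranged hn rfl (by omega) ((b + 1) * k - b * k) hd₁ le_rfl
      (by omega)
    obtain ⟨S, hS, hext⟩ := ih (b + 1) (by omega) hd₂
    refine ⟨S, hS, fun i j hij => ?_⟩
    have hi : i.val < b * k := (h.filled i j).1 hij
    rw [hext₁ i j hij, hagree i j hi]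
    exact hext i j ((hd₂.filled i j).2 (hi.trans_le hle))

/-- A completion fills every block. -/
theorem IsCompletion.isBlockFilling {k n : ℕ} {P : PartialGrid n} {S : FullGrid n}
    (h : IsCompletion k P S) (b d : ℕ) : IsBlockFilling k b d P S := by
  refine ⟨fun i j _ _ => ?_, fun i j i' j' hi hj hi' hj' hij => ?_⟩
  · by_cases hP : P i j = none
    · refine Or.inr ⟨hP, fun i' hi' => ?_⟩
      have h1 : S.toPartial i' j = some (S i j) := by rw [← h.2 i' j (by simp [hi']), hi']
      obtain rfl := h.1.2.1 i i' j _ rfl h1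
      simp [hP] at hi'
    · exact Or.inl (h.2 i j hP)
  · exact h.1.2.2 i j i' j' (S i j) (hi.trans hi'.symm) (hj.trans hj'.symm) rfl (congrArg some hij.symm)

theorem IsCompletion.isDraft {k n : ℕ} {P : PartialGrid n} {S : FullGrid n}
    (h : IsCompletion k P S) : IsDraft k n n S.toPartial :=
  ⟨h.1.2.1, h.1.2.2, fun i j j' x _ => h.1.1 i j j' x, fun i j => by simp [FullGrid.toPartial]⟩

/-- A rectangle can be completed if the blocks of its last band can be filled. -/
theorem IsDraft.exists_isCompletion_of_blocks {k n b q : ℕ} (hn : n = k ^ 2) {P : PartialGrid n}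
    (h : IsDraft k q q P) (hb : b < k) (hbq : b * k ≤ q) (hqb : q ≤ (b + 1) * k)
    (hfill : ∀ d < k, ∃ τ, IsBlockFilling k b d P τ) : ∃ S : FullGrid n, IsCompletion k P S := by
  obtain ⟨P₁, hP₁⟩ := IsBandFilling.exists_of_blocks k hfill
  obtain ⟨hd₁, hext₁⟩ := hP₁.isDraft hn h hbq
  rw [max_eq_right hqb] at hd₁
  -- Only the rows from `q` on are rearranged, so the given part of the band stays fixed.
  obtain ⟨P₂, hd₂, hagree⟩ := IsDraft.exists_arranged hn rfl hb ((b + 1) * k - q) hd₁ hbq (by omega)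
  obtain ⟨S, hS, hext⟩ := IsDraft.exists_isCompletion hn (k - (b + 1)) (b + 1) (by omega) hd₂
  refine ⟨S, hS, fun i j hij => ?_⟩
  have hi : i.val < q := (h.filled i j).1 hij
  rw [hext₁ i j hij, hagree i j hi]
  exact hext i j ((hd₂.filled i j).2 (hi.trans_le hqb))

/-! ### First-stage matchings and block fillings -/

section FirstStage

variable {k l r n : ℕ} {R : PartialGrid n} {d : Fin k}

/-- A matching in the first-stage graph yields a filling of the block. -/
theorem exists_isBlockFilling_of_hasPerfectMatching (hR : IsSudokuRectangle k (l * k + r) R)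
    (h : HasPerfectMatchingOneTo (k - r) (FirstStageAdj k l R d)) :
    ∃ τ, IsBlockFilling k l d R τ := by
  obtain ⟨M, hM, hcol, hsym⟩ := h
  -- For a column of the block, `g` lists the `k - r` symbols matched to it; the values elsewhere
  -- are irrelevant. The entry `g t` goes into row `l * k + r + t`.
  have hg : ∀ j : Fin n, ∃ g : ℕ → Fin n, ∀ hj : j.val / k = d.val,
      (∀ t < k - r, ∃ y : ElementVertex k l R d, y.val = g t ∧ M ⟨j, hj⟩ y) ∧
      ∀ t < k - r, ∀ t' < k - r, g t = g t' → t = t' := fun j => by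
    by_cases hj : j.val / k = d.val
    · obtain ⟨hfin, hcard⟩ := hcol ⟨j, hj⟩
      have := hfin.to_subtype
      let e := Finite.equivFinOfCardEq ((Nat.card_coe_set_eq _).trans hcard)
      refine ⟨fun t => if ht : t < k - r then (e.symm ⟨t, ht⟩).1.1 else j, fun _ =>
        ⟨fun t ht => ⟨(e.symm ⟨t, ht⟩).1, by simp [ht], (e.symm ⟨t, ht⟩).2⟩,
          fun t ht t' ht' htt => ?_⟩⟩
      simp only [ht, ht', dif_pos] at htt
      have := e.symm.injective (Subtype.ext (Subtype.ext htt))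
      exact Fin.mk.inj this
    · exact ⟨fun _ => j, fun h => absurd h hj⟩
  choose g hg using hg
  have hτ : ∀ i j, ∃ x, (i.val < l * k + r → R i j = some x) ∧
      (¬ i.val < l * k + r → x = g j (i.val - (l * k + r))) := fun i j => by
    by_cases hi : i.val < l * k + r
    · obtain ⟨x, hx⟩ := hR.isDraft.exists_eq_some hi j
      exact ⟨x, fun _ => hx, fun h => absurd hi h⟩
    · exact ⟨_, fun h => absurd h hi, fun _ => rfl⟩
  choose τ hτ₁ hτ₂ using hτ
  have hlt : ∀ i : Fin n, i.val / k = l → i.val < l * k + k := fun i hi => by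
    have := Nat.lt_mul_of_div_lt (Nat.lt_succ_of_le hi.le) d.pos
    rwa [Nat.succ_mul] at this
  have hnew : ∀ i j : Fin n, i.val / k = l → ∀ hj : j.val / k = d.val, ¬ i.val < l * k + r →
      ∃ y : ElementVertex k l R d, y.val = τ i j ∧ M ⟨j, hj⟩ y := fun i j hi hj him => by
    have := hlt i hi
    rw [hτ₂ i j him]
    exact (hg j hj).1 _ (by omega)
  refine ⟨τ, fun i j hi hj => ?_, fun i j i' j' hi hj hi' hj' hij => ?_⟩
  · by_cases him : i.val < l * k + r
    · exact Or.inl (hτ₁ i j him)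
    · obtain ⟨y, hy, hMy⟩ := hnew i j hi hj him
      refine Or.inr ⟨by_contra fun hne => him ((hR.2 i j).1 hne), fun i' => ?_⟩
      rw [← hy]
      exact hM _ _ hMy i'
  -- Two old cells are separated by the block condition of `R`. An old and a new cell differ because
  -- element vertices are absent from the filled cells of the block. Two new cells with one symbol
  -- share a column by uniqueness of its matched column, and then a row because `g` is injective.
  · by_cases him : i.val < l * k + r <;> by_cases him' : i'.val < l * k + r
    · exact hR.1.2.2 i j i' j' (τ i j) (hi.trans hi'.symm) (hj.trans hj'.symm) (hτ₁ i j him)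
        (hij ▸ hτ₁ i' j' him')
    · obtain ⟨y, hy, _⟩ := hnew i' j' hi' hj' him'
      exact absurd (hτ₁ i j him) (by rw [hij, ← hy]; exact y.2 i j hi hj)
    · obtain ⟨y, hy, _⟩ := hnew i j hi hj him
      exact absurd (hτ₁ i' j' him') (by rw [← hij, ← hy]; exact y.2 i' j' hi' hj')
    · obtain ⟨y, hy, hMy⟩ := hnew i j hi hj him
      obtain ⟨y', hy', hMy'⟩ := hnew i' j' hi' hj' him'
      obtain rfl : y = y' := Subtype.ext (hy.trans (hij.trans hy'.symm))
      obtain rfl : j = j' := congrArg Subtype.val ((hsym y).unique hMy hMy')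
      have h1 := hlt i hi
      have h2 := hlt i' hi'
      rw [hτ₂ i j him, hτ₂ i' j him'] at hij
      have := (hg j hj).2 _ (by omega) _ (by omega) hij
      exact ⟨Fin.ext (by omega), rfl⟩

/-- A completion yields a matching in every first-stage graph. -/
theorem IsCompletion.hasPerfectMatching (hn : n = k ^ 2) (hl : l < k)
    (hR : IsSudokuRectangle k (l * k + r) R) {S : FullGrid n} (hS : IsCompletion k R S) :
    HasPerfectMatchingOneTo (k - r) (FirstStageAdj k l R d) := by
  have hln : (l + 1) * k ≤ n := by rw [hn, sq]; exact Nat.mul_le_mul_right k hl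
  have hlk : (l + 1) * k = l * k + k := by ring
  have hRS : ∀ i j x, R i j = some x → i.val < l * k + r ∧ S i j = x := fun i j x hx =>
    ⟨hR.isDraft.lt_of_eq_some hx,
      Option.some.inj ((hS.2 i j (by simp [hx])).symm.trans hx)⟩
  -- A column is matched to the symbols that the completion puts into its `k - r` new cells of the
  -- block.
  refine ⟨fun j x => ∃ i : Fin n, l * k + r ≤ i.val ∧ i.val / k = l ∧ S i j.val = x.val,
    fun j x => ?_, fun j => ?_, fun x => ?_⟩
  · rintro ⟨i, hi, _, hx⟩ i' hi'
    obtain ⟨h1, h2⟩ := hRS _ _ _ hi'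
    have := hS.1.2.1 i i' j.val x.val (congrArg some hx) (congrArg some h2)
    subst this
    omega
  · have hband : ∀ t : Fin (k - r), (l * k + r + t.val) / k = l := fun t =>
      Nat.div_eq_of_lt_le (by omega) (by have := t.isLt; omega)
    let f : Fin (k - r) → ElementVertex k l R d := fun t =>
      ⟨S ⟨l * k + r + t.val, by omega⟩ j.val, fun i' j' hi' hj' h => by
        obtain ⟨h1, h2⟩ := hRS _ _ _ h
        have := (hS.1.2.2 _ _ i' j' _ ((hband t).trans hi'.symm) (j.2.trans hj'.symm) rfl
          (congrArg some h2)).1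
        subst this
        simp only at h1
        omega⟩
    have hf : Function.Injective f := fun t t' htt => by
      have := hS.1.2.1 _ _ j.val _ rfl (congrArg some (congrArg Subtype.val htt).symm)
      exact Fin.ext (by simpa using this)
    have hrange : {x : ElementVertex k l R d | ∃ i : Fin n, l * k + r ≤ i.val ∧ i.val / k = l ∧
        S i j.val = x.val} = Set.range f := by
      ext x
      constructor
      · rintro ⟨i, hi, hil, hx⟩
        have := Nat.lt_mul_of_div_lt (Nat.lt_succ_of_le hil.le) d.pos
        rw [Nat.succ_mul] at this
        refine ⟨⟨i.val - (l * k + r), by omega⟩, Subtype.ext ?_⟩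
        rw [← hx]
        exact congrArg (S · j.val) (Fin.ext (by simp only; omega))
      · rintro ⟨t, rfl⟩
        exact ⟨⟨l * k + r + t.val, by omega⟩, by simp, hband t, rfl⟩
    rw [hrange]
    refine ⟨Set.finite_range f, ?_⟩
    rw [← Set.image_univ, Set.ncard_image_of_injective _ hf, Set.ncard_univ, Nat.card_fin]
  -- The block is complete in `S`, so `x` occurs in it, and not in a row that `R` fills; the block
  -- condition makes the column unique.
  · obtain ⟨i, j, hi, hj, hx⟩ := hS.isDraft.exists_in_block hn hln hl d.isLt x.val
    have hx' : S i j = x.val := Option.some.inj hx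
    refine ⟨⟨j, hj⟩, ⟨i, ?_, hi, hx'⟩, ?_⟩
    · by_contra hlt
      refine x.2 i j hi hj ?_
      rw [hS.2 i j ((hR.2 i j).2 (by omega))]
      exact hx
    · rintro ⟨j', hj'⟩ ⟨i', _, hi', hx2⟩
      exact Subtype.ext (hS.1.2.2 i' j' i j x.val (hi'.trans hi.symm) (hj'.trans hj.symm)
        (congrArg some hx2) hx).2

end FirstStage

/-- The first-stage graphs decide whether a Sudoku rectangle can be completed. -/
theorem exists_isCompletion_iff {k n l r : ℕ} {R : PartialGrid n} (hn : n = k ^ 2) (hl : l < k)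
    (hr : r < k) (hR : IsSudokuRectangle k (l * k + r) R) :
    (∃ S : FullGrid n, IsCompletion k R S) ↔
      ∀ d : Fin k, HasPerfectMatchingOneTo (k - r) (FirstStageAdj k l R d) := by
  constructor
  · rintro ⟨S, hS⟩ d
    exact hS.hasPerfectMatching hn hl hR
  · intro h
    have : (l + 1) * k = l * k + k := by ring
    exact hR.isDraft.exists_isCompletion_of_blocks hn hl (by omega) (by omega) fun d hd =>
      exists_isBlockFilling_of_hasPerfectMatching hR (h ⟨d, hd⟩)

/-! ### Programs all of whose loops are bounded by a fixed register -/

namespace RAM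

/-- Commands whose loops run over the numbers below the content of register `2`. -/
inductive Cmd : Type
  | skip
  | assign (x : ℕ) (e : Expr)
  | store (a : ℕ) (addr e : Expr)
  | seq (p q : Cmd)
  | cond (e : Expr) (p q : Cmd)
  | forN (x : ℕ) (p : Cmd)

/-- The state before the pass number `i` through a loop with counter `x`. -/
def forIter (f : State → State) (x : ℕ) (s : State) : ℕ → State
  | 0 => s.setReg x 0
  | i + 1 => (f (forIter f x s i)).setReg x (i + 1)

namespace Cmd

/-- The state after the execution of a command. -/
def den : Cmd → State → State
  | skip => fun s => s
  | assign x e => fun s => s.setReg x (e.eval s)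
  | store a addr e => fun s => s.setArr a (addr.eval s) (e.eval s)
  | seq p q => fun s => q.den (p.den s)
  | cond e p q => fun s => if e.eval s = 0 then q.den s else p.den s
  | forN x p => fun s => forIter p.den x s (s.reg 2)

/-- The translation of commands to programs. -/
def toProg : Cmd → Prog
  | skip => .skip
  | assign x e => .assign x e
  | store a addr e => .store a addr e
  | seq p q => .seq p.toProg q.toProg
  | cond e p q => .cond e p.toProg q.toProg
  | forN x p => .seq (.assign x (.const 0)) (.loop (.sub (.reg 2) (.reg x))
      (.seq p.toProg (.assign x (.add (.reg x) (.const 1)))))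

/-- The registers that a command may change. -/
def writesReg : Cmd → ℕ → Bool
  | skip => fun _ => false
  | assign x _ => fun y => x == y
  | store _ _ _ => fun _ => false
  | seq p q => fun y => p.writesReg y || q.writesReg y
  | cond _ p q => fun y => p.writesReg y || q.writesReg y
  | forN x p => fun y => x == y || p.writesReg y

/-- The arrays that a command may change. -/
def writesArr : Cmd → ℕ → Bool
  | skip => fun _ => false
  | assign _ _ => fun _ => false
  | store a _ _ => fun b => a == b
  | seq p q => fun b => p.writesArr b || q.writesArr b
  | cond _ p q => fun b => p.writesArr b || q.writesArr b
  | forN _ p => fun b => p.writesArr b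

/-- The bodies of loops do not change the loop counters, and register `2` is never changed. -/
def wf : Cmd → Bool
  | skip => true
  | assign x _ => x != 2
  | store _ _ _ => true
  | seq p q => p.wf && q.wf
  | cond _ p q => p.wf && q.wf
  | forN x p => p.wf && (!p.writesReg x && x != 2)

/-- A polynomial that bounds the running time in terms of the content of register `2`. -/
noncomputable def time : Cmd → Polynomial ℕ
  | skip => 1
  | assign _ e => Polynomial.C (e.cost + 1)
  | store _ addr e => Polynomial.C (addr.cost + e.cost + 1)
  | seq p q => p.time + q.time
  | cond e p q => Polynomial.C (e.cost + 1) + (p.time + q.time)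
  | forN _ p => Polynomial.X * (p.time + 8) + 6

end Cmd

section State

variable (s : State) (x y a b i v : ℕ)

@[simp] theorem State.reg_setReg : (s.setReg x v).reg y = if y = x then v else s.reg y := by
  simp [State.setReg, Function.update_apply]

@[simp] theorem State.arr_setReg : (s.setReg x v).arr = s.arr := rfl

@[simp] theorem State.reg_setArr : (s.setArr a i v).reg = s.reg := rfl

theorem State.arr_setArr : (s.setArr a i v).arr b = if b = a then
    Function.update (s.arr a) i v else s.arr b := by
  simp [State.setArr, Function.update_apply]

end State

namespace Cmd

theorem den_seq (p q : Cmd) (s : State) : (seq p q).den s = q.den (p.den s) := rfl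

theorem den_assign (x : ℕ) (e : Expr) (s : State) : (assign x e).den s = s.setReg x (e.eval s) := rfl

theorem den_cond (e : Expr) (p q : Cmd) (s : State) :
    (cond e p q).den s = if e.eval s = 0 then q.den s else p.den s := rfl

/-- The set of written registers is computed syntactically, so for a concrete command the claim that
a register is unchanged reduces to `rfl`. The correctness proofs below rely on this throughout, as
on `arr_den` for arrays. -/
theorem reg_den (c : Cmd) {y : ℕ} (h : c.writesReg y = false) (s : State) :
    (c.den s).reg y = s.reg y := by
  induction c generalizing s with
  | skip => rfl
  | assign x e =>
    have : x ≠ y := by simpa [writesReg] using h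
    simp [den, this.symm]
  | store a addr e => rfl
  | seq p q ihp ihq =>
    simp only [writesReg, Bool.or_eq_false_iff] at h
    simp only [den, ihq h.2, ihp h.1]
  | cond e p q ihp ihq =>
    simp only [writesReg, Bool.or_eq_false_iff] at h
    simp only [den]
    split_ifs
    · exact ihq h.2 s
    · exact ihp h.1 s
  | forN x p ih =>
    simp only [writesReg, Bool.or_eq_false_iff, beq_eq_false_iff_ne] at h
    simp only [den]
    induction s.reg 2 with
    | zero => simp [forIter, h.1.symm]
    | succ n ihn => simp [forIter, h.1.symm, ih h.2, ihn]

theorem arr_den (c : Cmd) {b : ℕ} (h : c.writesArr b = false) (s : State) :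
    (c.den s).arr b = s.arr b := by
  induction c generalizing s with
  | skip => rfl
  | assign x e => rfl
  | store a addr e =>
    have : a ≠ b := by simpa [writesArr] using h
    simp [den, State.arr_setArr, this.symm]
  | seq p q ihp ihq =>
    simp only [writesArr, Bool.or_eq_false_iff] at h
    simp only [den, ihq h.2, ihp h.1]
  | cond e p q ihp ihq =>
    simp only [writesArr, Bool.or_eq_false_iff] at h
    simp only [den]
    split_ifs
    · exact ihq h.2 s
    · exact ihp h.1 s
  | forN x p ih =>
    simp only [writesArr] at h
    simp only [den]
    induction s.reg 2 with
    | zero => simp [forIter]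
    | succ n ihn => simp [forIter, ih h, ihn]

/-- The two states agree up to registers and arrays that the command may change. -/
structure Frame (c : Cmd) (s s' : State) : Prop where
  reg : ∀ y, c.writesReg y = false → s'.reg y = s.reg y
  arr : ∀ b, c.writesArr b = false → s'.arr b = s.arr b

theorem frame_den (c : Cmd) (s : State) : Frame c s (c.den s) :=
  ⟨fun _ h => c.reg_den h s, fun _ h => c.arr_den h s⟩

theorem reg_forIter {x : ℕ} {p : Cmd} (s : State) (i : ℕ) : (forIter p.den x s i).reg x = i := by
  cases i <;> simp [forIter]

theorem frame_forIter (x : ℕ) (p : Cmd) (s : State) (i : ℕ) :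
    Frame (forN x p) s (forIter p.den x s i) := by
  constructor
  · intro y h
    have h' := h
    simp only [writesReg, Bool.or_eq_false_iff, beq_eq_false_iff_ne] at h'
    induction i with
    | zero => simp [forIter, h'.1.symm]
    | succ n ihn => simp [forIter, h'.1.symm, reg_den p h'.2, ihn]
  · intro b h
    have h' : p.writesArr b = false := h
    induction i with
    | zero => simp [forIter]
    | succ n ihn => simp [forIter, arr_den p h', ihn]

/-- The loop rule. -/
theorem forN_induction {x : ℕ} {p : Cmd} {s : State} (I : ℕ → State → Prop) (h0 : I 0 (s.setReg x 0))
    (hstep : ∀ i s', i < s.reg 2 → s'.reg x = i → Frame (forN x p) s s' → I i s' →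
      I (i + 1) ((p.den s').setReg x (i + 1))) :
    I (s.reg 2) ((forN x p).den s) := by
  have : ∀ i, i ≤ s.reg 2 → I i (forIter p.den x s i) := by
    intro i
    induction i with
    | zero => exact fun _ => h0
    | succ i ih =>
      exact fun hi => hstep i _ hi (reg_forIter s i) (frame_forIter x p s i) (ih (by omega))
  exact this _ le_rfl

/-- Register `2` bounds every loop. Since it is constant, the time polynomials of all subcommands
are evaluated at the same number. -/
theorem reg_two_den {c : Cmd} (h : c.wf = true) (s : State) : (c.den s).reg 2 = s.reg 2 := by
  refine reg_den c ?_ s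
  induction c with
  | skip => rfl
  | assign x e => simpa [wf, writesReg] using h
  | store a addr e => rfl
  | seq p q ihp ihq =>
    simp only [wf, Bool.and_eq_true] at h
    simp [writesReg, ihp h.1, ihq h.2]
  | cond e p q ihp ihq =>
    simp only [wf, Bool.and_eq_true] at h
    simp [writesReg, ihp h.1, ihq h.2]
  | forN x p ih =>
    simp only [wf, Bool.and_eq_true, bne_iff_ne] at h
    simp [writesReg, ih h.1, h.2.2]

/-- Commands run in polynomial time. -/
theorem exec_toProg {c : Cmd} (h : c.wf = true) (s : State) :
    ∃ t, t ≤ c.time.eval (s.reg 2) ∧ Exec c.toProg s t (c.den s) := by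
  induction c generalizing s with
  | skip => exact ⟨1, by simp [time], .skip s⟩
  | assign x e => exact ⟨_, by simp [time], .assign s x e⟩
  | store a addr e => exact ⟨_, by simp [time], .store s a addr e⟩
  | seq p q ihp ihq =>
    simp only [wf, Bool.and_eq_true] at h
    obtain ⟨t₁, h₁, e₁⟩ := ihp h.1 s
    obtain ⟨t₂, h₂, e₂⟩ := ihq h.2 (p.den s)
    rw [reg_two_den h.1] at h₂
    exact ⟨t₁ + t₂, by simp only [time, Polynomial.eval_add]; omega, .seq e₁ e₂⟩
  | cond e p q ihp ihq =>
    simp only [wf, Bool.and_eq_true] at h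
    obtain ⟨t₁, h₁, e₁⟩ := ihp h.1 s
    obtain ⟨t₂, h₂, e₂⟩ := ihq h.2 s
    by_cases he : e.eval s = 0
    · refine ⟨e.cost + 1 + t₂, ?_, ?_⟩
      · simp only [time, Polynomial.eval_add, Polynomial.eval_C]; omega
      · simp only [den, he, if_true]
        exact .cond_false he e₂
    · refine ⟨e.cost + 1 + t₁, ?_, ?_⟩
      · simp only [time, Polynomial.eval_add, Polynomial.eval_C]; omega
      · simp only [den, he, if_false]
        exact .cond_true he e₁
  | forN x p ih =>
    simp only [wf, Bool.and_eq_true, bne_iff_ne, Bool.not_eq_true'] at h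
    obtain ⟨hwf, hx, hx2⟩ := h
    have hreg : ∀ i, (forIter p.den x s i).reg 2 = s.reg 2 := fun i => by
      induction i with
      | zero => simp [forIter, hx2.symm]
      | succ i ihi => simp [forIter, hx2.symm, reg_two_den hwf, ihi]
    -- Induction on the number `j` of remaining passes. A pass costs four steps for the test and
    -- four for the increment besides the body, whence the `8`; the last test costs four and the
    -- initialisation two, whence the `6` in `time`.
    have main : ∀ j i, i + j = s.reg 2 → ∃ t, t ≤ j * (p.time.eval (s.reg 2) + 8) + 4 ∧
        Exec (.loop (.sub (.reg 2) (.reg x)) (.seq p.toProg (.assign x (.add (.reg x) (.const 1)))))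
          (forIter p.den x s i) t (forIter p.den x s (s.reg 2)) := by
      intro j
      induction j with
      | zero =>
        intro i hi
        obtain rfl : i = s.reg 2 := hi
        exact ⟨_, by simp [Expr.cost],
          .loop_false (by simp [Expr.eval, hreg, reg_forIter])⟩
      | succ j ihj =>
        intro i hi
        obtain ⟨t₁, h₁, e₁⟩ := ih hwf (forIter p.den x s i)
        obtain ⟨t₂, h₂, e₂⟩ := ihj (i + 1) (by omega)
        have e₃ := Exec.assign (p.den (forIter p.den x s i)) x (.add (.reg x) (.const 1))
        have heval : (Expr.add (.reg x) (.const 1)).eval (p.den (forIter p.den x s i)) = i + 1 := by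
          simp [Expr.eval, reg_den p hx, reg_forIter]
        rw [heval] at e₃
        rw [hreg] at h₁
        refine ⟨_, ?_, .loop_true ?_ (.seq e₁ e₃) e₂⟩
        · simp only [Expr.cost]
          rw [Nat.succ_mul]
          omega
        · simp only [Expr.eval, hreg, reg_forIter]
          omega
    obtain ⟨t, ht, e⟩ := main (s.reg 2) 0 (by omega)
    refine ⟨_, ?_, .seq (.assign s x (.const 0)) e⟩
    simp only [time, Polynomial.eval_add, Polynomial.eval_mul, Polynomial.eval_X, Expr.cost,
      Polynomial.eval_ofNat]
    omega

end Cmd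

end RAM

/-! ### Searching and matching -/

namespace RAM

/-- The value is `1` if the two expressions have the same value, and `0` otherwise. -/
def Expr.eqTest (e₁ e₂ : Expr) : Expr := .sub (.const 1) (.add (.sub e₁ e₂) (.sub e₂ e₁))

/-- The predecessor. -/
def Expr.pred (e : Expr) : Expr := .sub e (.const 1)

/-- The successor. -/
def Expr.succ (e : Expr) : Expr := .add e (.const 1)

@[simp] theorem Expr.eval_eqTest (e₁ e₂ : Expr) (s : State) :
    (Expr.eqTest e₁ e₂).eval s = if e₁.eval s = e₂.eval s then 1 else 0 := by
  simp only [Expr.eqTest, Expr.eval]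
  split_ifs <;> omega

@[simp] theorem Expr.eval_pred (e : Expr) (s : State) : e.pred.eval s = e.eval s - 1 := rfl

@[simp] theorem Expr.eval_succ (e : Expr) (s : State) : e.succ.eval s = e.eval s + 1 := rfl

attribute [simp] Expr.eval

/-- Write `i + 1` into register `r` for some `i` for which the expression `e` is nonzero when register `x`
contains `i`, and `0` if there is no such `i`. -/
def find (r x : ℕ) (e : Expr) : Cmd :=
  .seq (.assign r (.const 0)) (.forN x (.cond e (.assign r (.succ (.reg x))) .skip))

/-- The search changes only `r` and `x`, so the test need be understood only in states that agree
with `s` elsewhere. Results are shifted by one to keep `0` free for failure. -/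
theorem find_spec {r x : ℕ} {e : Expr} {s : State} (hrx : r ≠ x) (hr : r ≠ 2) (f : ℕ → Prop)
    (hf : ∀ i s', i < s.reg 2 → s'.arr = s.arr → (∀ y, y ≠ r → y ≠ x → s'.reg y = s.reg y) →
      s'.reg x = i → (e.eval s' ≠ 0 ↔ f i)) :
    (((find r x e).den s).reg r = 0 ∧ ∀ i < s.reg 2, ¬ f i) ∨
      ∃ i < s.reg 2, f i ∧ ((find r x e).den s).reg r = i + 1 := by
  have h2 : (s.setReg r 0).reg 2 = s.reg 2 := by simp [hr.symm]
  have := Cmd.forN_induction (x := x) (p := .cond e (.assign r (.succ (.reg x))) .skip)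
    (s := s.setReg r 0)
    (fun i s' => (s'.reg r = 0 ∧ ∀ j < i, ¬ f j) ∨ ∃ j < i, f j ∧ s'.reg r = j + 1)
    (Or.inl (by simp [hrx])) ?_
  · rw [h2] at this
    exact this
  · intro i s' hi hx hF hI
    rw [h2] at hi
    have harr : s'.arr = s.arr := funext fun b => hF.arr b rfl
    have hreg : ∀ y, y ≠ r → y ≠ x → s'.reg y = s.reg y := fun y h3 h4 => by
      rw [hF.reg y (by simp [Cmd.writesReg, h3.symm, h4.symm])]
      simp [h3]
    have hfi := hf i s' hi harr hreg hx
    by_cases he : e.eval s' = 0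
    · have hnf : ¬ f i := fun h => hfi.2 h he
      simp only [Cmd.den, he, if_true, State.reg_setReg, hrx, if_false]
      rcases hI with ⟨h3, h4⟩ | ⟨j, h3, h4⟩
      · refine Or.inl ⟨h3, fun j hj => ?_⟩
        rcases Nat.lt_succ_iff_lt_or_eq.1 hj with h5 | rfl
        · exact h4 j h5
        · exact hnf
      · exact Or.inr ⟨j, by omega, h4⟩
    · exact Or.inr ⟨i, by omega, hfi.1 he, by simp [Cmd.den, he, hrx, hx]⟩

theorem find_arr (r x : ℕ) (e : Expr) (s : State) : ((find r x e).den s).arr = s.arr :=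
  funext fun _ => Cmd.arr_den _ rfl s

theorem find_reg {r x y : ℕ} (e : Expr) (s : State) (hr : y ≠ r) (hx : y ≠ x) :
    ((find r x e).den s).reg y = s.reg y :=
  Cmd.reg_den _ (by simp [find, Cmd.writesReg, hr.symm, hx.symm]) s

/-- The tables for multiplication by `n` and for division by `k`. -/
structure HasTables (k n : ℕ) (s : State) : Prop where
  size : s.reg 2 = n
  row : ∀ i < n, s.arr 2 i = i * n
  div : ∀ i < n, s.arr 4 i = i / k
  mod : ∀ i < n, s.arr 5 i = i % k

theorem HasTables.of_frame {k n : ℕ} {c : Cmd} {s s' : State} (h : HasTables k n s)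
    (hF : Cmd.Frame c s s')
    (hc : (c.writesReg 2 || c.writesArr 2 || c.writesArr 4 || c.writesArr 5) = false) :
    HasTables k n s' := by
  simp only [Bool.or_eq_false_iff] at hc
  obtain ⟨⟨⟨h1, h2⟩, h3⟩, h4⟩ := hc
  refine ⟨?_, ?_, ?_, ?_⟩
  · rw [hF.reg 2 h1]; exact h.size
  · rw [hF.arr 2 h2]; exact h.row
  · rw [hF.arr 4 h3]; exact h.div
  · rw [hF.arr 5 h4]; exact h.mod

/-! ### The auction algorithm as a program -/

/-- Write `v + 1` into register `15` for a neighbour `v` of minimal price of the vertex whose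
successor stands in register `14`, and `0` if there is no neighbour. -/
def cheapest : Cmd :=
  .seq (.assign 15 (.const 0)) (.forN 13 (.cond (.load 6 (.add (.load 2 (.pred (.reg 14))) (.reg 13)))
    (.cond (.add (.sub (.const 1) (.reg 15)) (.sub (.load 8 (.pred (.reg 15))) (.load 8 (.reg 13))))
      (.assign 15 (.succ (.reg 13))) .skip) .skip))

/-- The inner test is a disjunction written as a sum. While register `15` is `0`, its first summand
is `1`, so the first neighbour is always accepted and the meaningless price comparison does no harm.
Later the first summand vanishes, and the second is nonzero exactly for a strictly cheaper
candidate. -/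
theorem cheapest_spec (s : State) (g : ℕ → ℕ)
    (hg : ∀ v < s.reg 2, s.arr 6 (s.arr 2 (s.reg 14 - 1) + v) = g v) :
    ((cheapest.den s).reg 15 = 0 ∧ ∀ v < s.reg 2, g v = 0) ∨
      ∃ v < s.reg 2, (cheapest.den s).reg 15 = v + 1 ∧ g v ≠ 0 ∧
        ∀ w < s.reg 2, g w ≠ 0 → s.arr 8 v ≤ s.arr 8 w := by
  refine Cmd.forN_induction (x := 13) (s := s.setReg 15 0)
    (fun i s' => (s'.reg 15 = 0 ∧ ∀ v < i, g v = 0) ∨ ∃ v < s.reg 2, s'.reg 15 = v + 1 ∧ g v ≠ 0 ∧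
        ∀ w < i, g w ≠ 0 → s.arr 8 v ≤ s.arr 8 w) (Or.inl (by simp)) ?_
  intro i s' hi hx hF hI
  have hi' : i < s.reg 2 := by simpa using hi
  have h14 : s'.reg 14 = s.reg 14 := hF.reg 14 rfl
  have h2 : s'.arr 2 = s.arr 2 := hF.arr 2 rfl
  have h6 : s'.arr 6 = s.arr 6 := hF.arr 6 rfl
  have h8 : s'.arr 8 = s.arr 8 := hF.arr 8 rfl
  simp only [Cmd.den, Expr.eval, Expr.eval_pred, Expr.eval_succ, hx, h14, h2, h6, h8, hg i hi']
  by_cases hgi : g i = 0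
  · simp only [hgi, if_true, State.reg_setReg]
    rcases hI with ⟨h3, h4⟩ | ⟨v, hv, h3, h4, h5⟩
    · refine Or.inl ⟨by simpa using h3, fun j hj => ?_⟩
      rcases Nat.lt_succ_iff_lt_or_eq.1 hj with h | rfl
      · exact h4 j h
      · exact hgi
    · refine Or.inr ⟨v, hv, by simpa using h3, h4, fun j hj => ?_⟩
      rcases Nat.lt_succ_iff_lt_or_eq.1 hj with h | rfl
      · exact h5 j h
      · exact fun h => absurd hgi h
  · simp only [hgi, if_false]
    right
    rcases hI with ⟨h3, h4⟩ | ⟨v, hv, h3, h4, h5⟩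
    · refine ⟨i, hi', by simp [h3], hgi, fun w hw hgw => ?_⟩
      rcases Nat.lt_succ_iff_lt_or_eq.1 hw with h | rfl
      · exact absurd (h4 w h) hgw
      · exact le_rfl
    · by_cases hlt : s.arr 8 i < s.arr 8 v
      · refine ⟨i, hi', ?_, hgi, fun w hw hgw => ?_⟩
        · have : ¬ s.arr 8 v - s.arr 8 i = 0 := by omega
          simp [h3, this]
        · rcases Nat.lt_succ_iff_lt_or_eq.1 hw with h | rfl
          · exact hlt.le.trans (h5 w h hgw)
          · exact le_rfl
      · refine ⟨v, hv, ?_, h4, fun w hw hgw => ?_⟩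
        · have : s.arr 8 v - s.arr 8 i = 0 := by omega
          simp [h3, this]
        · rcases Nat.lt_succ_iff_lt_or_eq.1 hw with h | rfl
          · exact h5 w h hgw
          · omega

/-- Remove the mates of the vertex whose successor stands in register `15`. -/
def release : Cmd :=
  .forN 13 (.cond (.eqTest (.load 7 (.reg 13)) (.reg 15)) (.store 7 (.reg 13) (.const 0)) .skip)

theorem release_spec (s : State) {u : ℕ} (hu : u < s.reg 2) :
    (release.den s).arr 7 u = if s.arr 7 u = s.reg 15 then 0 else s.arr 7 u := by
  have := Cmd.forN_induction (x := 13) (s := s) (p := .cond (.eqTest (.load 7 (.reg 13)) (.reg 15))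
    (.store 7 (.reg 13) (.const 0)) .skip)
    (fun i s' => ∀ u, s'.arr 7 u = if u < i ∧ s.arr 7 u = s.reg 15 then 0 else s.arr 7 u)
    (by simp) ?_
  · rw [release, this u]
    simp [hu]
  · intro i s' hi hx hF hI u
    have h15 : s'.reg 15 = s.reg 15 := hF.reg 15 rfl
    -- Pass `i` reads entry `i` before any pass has changed it.
    have hIi := hI i
    simp only [lt_self_iff_false, false_and, if_false] at hIi
    simp only [Cmd.den, Expr.eval_eqTest, Expr.eval, hx, h15, hIi, State.arr_setReg]
    by_cases hc : s.arr 7 i = s.reg 15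
    · simp only [hc, if_true, one_ne_zero, if_false, State.arr_setArr]
      rcases eq_or_ne u i with rfl | hne
      · simp [hc]
      · rw [Function.update_of_ne hne, hI u]
        have : u < i + 1 ↔ u < i := by omega
        simp [this]
    · simp only [hc, if_false, if_true, hI u]
      rcases eq_or_ne u i with rfl | hne
      · simp [hc]
      · have : u < i + 1 ↔ u < i := by omega
        simp [this]

/-- One step of the auction algorithm: an unmatched vertex takes over its cheapest neighbour. -/
def bid : Cmd :=
  .seq (find 14 13 (.eqTest (.load 7 (.reg 13)) (.const 0)))
    (.cond (.reg 14)
      (.seq cheapest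
        (.cond (.reg 15)
          (.seq release
            (.seq (.store 7 (.pred (.reg 14)) (.reg 15))
              (.store 8 (.pred (.reg 15)) (.succ (.load 8 (.pred (.reg 15)))))))
          .skip))
      .skip)

/-- Array `6` contains the adjacency matrix of the relation `adj`. -/
def IsAdjMatrix (n : ℕ) (adj : Fin n → Fin n → Prop) (s : State) : Prop :=
  ∀ u v : Fin n, s.arr 6 (u.val * n + v.val) ≠ 0 ↔ adj u v

/-- Arrays `7` and `8` contain the matching and the prices after `T` steps of the auction algorithm. -/
def AuctionState (n : ℕ) (adj : Fin n → Fin n → Prop) (T : ℕ) (s : State) : Prop :=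
  ∃ (mate : Fin n → Option (Fin n)) (price : Fin n → ℕ),
    (∀ u, s.arr 7 u.val = cellCode (mate u)) ∧ (∀ v, s.arr 8 v.val = price v) ∧
      IsAuction adj mate price ∧ AuctionProgress adj mate price T

theorem cellCode_eq_zero {n : ℕ} {x : Option (Fin n)} : cellCode x = 0 ↔ x = none := by
  cases x <;> simp [cellCode]

theorem cellCode_eq_succ {n : ℕ} {x : Option (Fin n)} {v : Fin n} :
    cellCode x = v.val + 1 ↔ x = some v := by
  cases x <;> simp [cellCode, Fin.ext_iff]

/-- There are three outcomes. If no vertex is unmatched, the state is kept and the first alternative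
of the progress statement holds. If the unmatched vertex has no neighbour, there is no perfect
matching by `exists_cheap`, and progress is vacuous. Otherwise the program performs the abstract
bid. -/
theorem AuctionState.bid {k n T : ℕ} {adj : Fin n → Fin n → Prop} {s : State} (ht : HasTables k n s)
    (hadj : IsAdjMatrix n adj s) (h : AuctionState n adj T s) :
    AuctionState n adj (T + 1) (bid.den s) := by
  obtain ⟨mate, price, hmate, hprice, hI, hP⟩ := h
  have hfind := find_spec (r := 14) (x := 13) (e := .eqTest (.load 7 (.reg 13)) (.const 0)) (s := s)
    (by decide) (by decide) (fun u => s.arr 7 u = 0) (by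
      intro i s' _ harr _ hx
      simp [harr, hx])
  have harr := find_arr 14 13 (.eqTest (.load 7 (.reg 13)) (.const 0)) s
  have h2 : ((find 14 13 (.eqTest (.load 7 (.reg 13)) (.const 0))).den s).reg 2 = s.reg 2 :=
    find_reg _ s (by decide) (by decide)
  simp only [RAM.bid, Cmd.den]
  generalize (find 14 13 (.eqTest (.load 7 (.reg 13)) (.const 0))).den s = s₁ at hfind harr h2 ⊢
  simp only [Expr.eval]
  rcases hfind with ⟨h14, hall⟩ | ⟨x, hx, hx0, h14⟩
  · simp only [h14, if_true]
    refine ⟨mate, price, by rwa [harr], by rwa [harr], hI, fun hm => ⟨(hP hm).1, Or.inl fun u hu => ?_⟩⟩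
    exact hall u (by rw [ht.size]; exact u.isLt) (by rw [hmate, hu]; rfl)
  · rw [ht.size] at hx
    lift x to Fin n using hx
    rw [hmate, cellCode_eq_zero] at hx0
    have hne : ¬ s₁.reg 14 = 0 := by omega
    simp only [hne, if_false]
    have hch := cheapest_spec s₁ (fun v => s.arr 6 (x.val * n + v)) (by
      intro v _
      rw [harr, h14, Nat.add_sub_cancel, ht.row x x.isLt])
    have hF := Cmd.frame_den cheapest s₁
    rw [h2, ht.size, harr] at hch
    have g14 : (cheapest.den s₁).reg 14 = x.val + 1 := (hF.reg 14 rfl).trans h14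
    have g2 : (cheapest.den s₁).reg 2 = n := (hF.reg 2 rfl).trans (h2.trans ht.size)
    have g7 : (cheapest.den s₁).arr 7 = s.arr 7 := (hF.arr 7 rfl).trans (by rw [harr])
    have g8 : (cheapest.den s₁).arr 8 = s.arr 8 := (hF.arr 8 rfl).trans (by rw [harr])
    generalize cheapest.den s₁ = s₂ at hch g14 g2 g7 g8 ⊢
    rcases hch with ⟨h15, hall⟩ | ⟨y, hy, h15, hxy, hmin⟩
    · simp only [h15, if_true]
      refine ⟨mate, price, by rwa [g7], by rwa [g8], hI, fun hm => ?_⟩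
      obtain ⟨w, hw, _⟩ := hI.exists_cheap hm hx0
      exact absurd (hall w w.isLt) ((hadj x w).2 hw)
    · lift y to Fin n using hy
      have hne : ¬ s₂.reg 15 = 0 := by omega
      simp only [hne, if_false]
      have hrel := fun u : Fin n => release_spec s₂ (u := u.val) (by rw [g2]; exact u.isLt)
      have hF := Cmd.frame_den release s₂
      have k14 : (release.den s₂).reg 14 = x.val + 1 := (hF.reg 14 rfl).trans g14
      have k15 : (release.den s₂).reg 15 = y.val + 1 := (hF.reg 15 rfl).trans h15
      have k8 : (release.den s₂).arr 8 = s.arr 8 := (hF.arr 8 rfl).trans g8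
      rw [g7, h15] at hrel
      generalize release.den s₂ = s₃ at hrel k14 k15 k8 ⊢
      have hxy' := (hadj x y).1 hxy
      have hmin' : ∀ w, adj x w → price y ≤ price w := fun w hw => by
        rw [← hprice, ← hprice]
        exact hmin w w.isLt ((hadj x w).2 hw)
      refine ⟨_, _, fun u => ?_, fun v => ?_, hI.bid hx0 hxy' hmin', hP.bid hI hx0 hmin' _⟩
      · simp only [State.arr_setArr, Expr.eval_pred, Expr.eval, State.reg_setArr, k14, k15,
          Nat.add_sub_cancel, Nat.reduceEqDiff, if_false, if_true, Function.update_apply,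
          Fin.val_inj, hrel u, hmate u, cellCode_eq_succ]
        split_ifs <;> rfl
      · simp only [State.arr_setArr, Expr.eval_pred, Expr.eval_succ, Expr.eval, State.reg_setArr, k14,
          k15, k8, Nat.add_sub_cancel, Nat.reduceEqDiff, if_false, if_true, Function.update_apply,
          Fin.val_inj, hprice]

/-- The auction algorithm. -/
def matching : Cmd :=
  .seq (.forN 13 (.seq (.store 7 (.reg 13) (.const 0)) (.store 8 (.reg 13) (.const 0))))
    (.seq (.forN 11 (.forN 12 bid)) bid)

/-- The nested loops make `n * n` bids. The additional bid pushes their number strictly above `n *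
n`, the largest possible total price if a perfect matching exists. -/
theorem matching_spec {k n : ℕ} {adj : Fin n → Fin n → Prop} {s : State} (ht : HasTables k n s)
    (hadj : IsAdjMatrix n adj s) : ∃ mate : Fin n → Option (Fin n),
      (∀ u, (matching.den s).arr 7 u.val = cellCode (mate u)) ∧
      (∀ u u' v, mate u = some v → mate u' = some v → u = u') ∧
      (∀ u v, mate u = some v → adj u v) ∧ (HasMatching adj → ∀ u, mate u ≠ none) := by
  have h0 := Cmd.forN_induction (x := 13) (s := s)
    (p := .seq (.store 7 (.reg 13) (.const 0)) (.store 8 (.reg 13) (.const 0)))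
    (fun i s' => ∀ u < i, s'.arr 7 u = 0 ∧ s'.arr 8 u = 0) (by simp) (by
      intro i s' _ hx _ hI u hu
      simp only [Cmd.den, Expr.eval, State.arr_setArr, State.reg_setArr, State.arr_setReg, hx]
      rcases eq_or_ne u i with rfl | hne
      · simp
      · simp [hne, hI u (by omega)])
  have hF := Cmd.frame_den (.forN 13 (.seq (.store 7 (.reg 13) (.const 0))
    (.store 8 (.reg 13) (.const 0)))) s
  rw [matching, Cmd.den_seq, Cmd.den_seq]
  generalize Cmd.den (.forN 13 (.seq (.store 7 (.reg 13) (.const 0))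
    (.store 8 (.reg 13) (.const 0)))) s = s₁ at h0 hF ⊢
  have ht₁ : HasTables k n s₁ := ht.of_frame hF rfl
  have hadj₁ : IsAdjMatrix n adj s₁ := by rw [IsAdjMatrix, hF.arr 6 rfl]; exact hadj
  rw [ht.size] at h0
  have hA : AuctionState n adj 0 s₁ :=
    ⟨fun _ => none, fun _ => 0, fun u => (h0 u u.isLt).1, fun u => (h0 u u.isLt).2,
      IsAuction.empty adj, fun _ => ⟨fun _ => Nat.zero_le _, Or.inr (by simp)⟩⟩
  have hB := Cmd.forN_induction (x := 11) (s := s₁) (p := .forN 12 RAM.bid)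
    (fun i s' => AuctionState n adj (i * n) s') (by rw [zero_mul]; exact hA) (by
      intro i s' _ _ hF₂ hI
      have ht₂ : HasTables k n s' := ht₁.of_frame hF₂ rfl
      have hadj₂ : IsAdjMatrix n adj s' := by rw [IsAdjMatrix, hF₂.arr 6 rfl]; exact hadj₁
      have := Cmd.forN_induction (x := 12) (s := s') (p := RAM.bid)
        (fun j s'' => AuctionState n adj (i * n + j) s'') hI (by
          intro j s'' _ _ hF₃ hI₃
          have ht₃ : HasTables k n s'' := ht₂.of_frame hF₃ rfl
          have hadj₃ : IsAdjMatrix n adj s'' := by rw [IsAdjMatrix, hF₃.arr 6 rfl]; exact hadj₂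
          exact hI₃.bid ht₃ hadj₃)
      rw [ht₂.size, ← Nat.succ_mul] at this
      exact this)
  have hF₂ := Cmd.frame_den (.forN 11 (.forN 12 RAM.bid)) s₁
  rw [ht₁.size] at hB
  have ht₂ := ht₁.of_frame hF₂ rfl
  have hadj₂ : IsAdjMatrix n adj (Cmd.den (.forN 11 (.forN 12 RAM.bid)) s₁) := by
    rw [IsAdjMatrix, hF₂.arr 6 rfl]; exact hadj₁
  obtain ⟨mate, price, hmate, _, hI, hP⟩ := hB.bid ht₂ hadj₂
  exact ⟨mate, hmate, hI.inj, hI.adj_of_mate, fun hm u => hP.all_matched (by simp) hm u⟩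

/-- Find a perfect matching, or write `1` into register `4` if there is none. -/
def solve : Cmd :=
  .seq matching (.seq (find 10 9 (.eqTest (.load 7 (.reg 9)) (.const 0)))
    (.cond (.reg 10) (.assign 4 (.const 1)) .skip))

/-- A vertex left unmatched by the auction certifies that there is no perfect matching. Register `4`
is a failure flag that is only ever raised, so on success it keeps its previous value. -/
theorem solve_spec {k n : ℕ} {adj : Fin n → Fin n → Prop} {s : State} (ht : HasTables k n s)
    (hadj : IsAdjMatrix n adj s) :
    ((solve.den s).reg 4 = 1 ∧ ¬ HasMatching adj) ∨ ((solve.den s).reg 4 = s.reg 4 ∧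
      ∃ σ : Fin n → Fin n, Function.Injective σ ∧ (∀ u, adj u (σ u)) ∧
        ∀ u : Fin n, (solve.den s).arr 7 u.val = (σ u).val + 1) := by
  obtain ⟨mate, hmate, hinj, hadj', hall⟩ := matching_spec ht hadj
  have hF := Cmd.frame_den matching s
  rw [solve, Cmd.den_seq, Cmd.den_seq]
  generalize matching.den s = s₁ at hmate hF ⊢
  have ht₁ : HasTables k n s₁ := ht.of_frame hF rfl
  have hfind := find_spec (r := 10) (x := 9) (e := .eqTest (.load 7 (.reg 9)) (.const 0)) (s := s₁)
    (by decide) (by decide) (fun u => s₁.arr 7 u = 0) (by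
      intro i s' _ harr _ hx
      simp [harr, hx])
  have hF₂ := Cmd.frame_den (find 10 9 (.eqTest (.load 7 (.reg 9)) (.const 0))) s₁
  generalize (find 10 9 (.eqTest (.load 7 (.reg 9)) (.const 0))).den s₁ = s₂ at hfind hF₂ ⊢
  rw [ht₁.size] at hfind
  rcases hfind with ⟨h10, h3⟩ | ⟨u, hu, hu0, h10⟩
  · right
    have h4 : ∀ u, ∃ v, mate u = some v := fun u => Option.ne_none_iff_exists'.1 fun hu =>
      h3 u u.isLt (by rw [hmate, hu]; rfl)
    choose σ hσ using h4
    simp only [Cmd.den, Expr.eval, h10, if_true]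
    refine ⟨(hF₂.reg 4 rfl).trans (hF.reg 4 rfl), σ, fun u u' huu => ?_, fun u => hadj' u _ (hσ u),
      fun u => ?_⟩
    · exact hinj u u' _ (hσ u) (by rw [huu]; exact hσ u')
    · rw [hF₂.arr 7 rfl, hmate, hσ]; rfl
  · left
    have hne : ¬ s₂.reg 10 = 0 := by omega
    simp only [Cmd.den, Expr.eval, hne, if_false, State.reg_setReg, if_true, true_and]
    intro hm
    exact hall hm ⟨u, hu⟩ (cellCode_eq_zero.1 ((hmate ⟨u, hu⟩).symm.trans hu0))

end RAM

/-! ### Filling a block and arranging a row -/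

namespace RAM

theorem Cmd.Frame.trans {c d e : Cmd} {s s' s'' : State} (h : Cmd.Frame c s s')
    (h' : Cmd.Frame d s' s'')
    (hr : ∀ y, e.writesReg y = false → c.writesReg y = false ∧ d.writesReg y = false)
    (ha : ∀ b, e.writesArr b = false → c.writesArr b = false ∧ d.writesArr b = false) :
    Cmd.Frame e s s'' :=
  ⟨fun y hy => (h'.reg y (hr y hy).2).trans (h.reg y (hr y hy).1),
    fun b hb => (h'.arr b (ha b hb).2).trans (h.arr b (ha b hb).1)⟩

theorem address_inj {n i j i' j' : ℕ} (hj : j < n) (hj' : j' < n) :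
    i * n + j = i' * n + j' ↔ i = i' ∧ j = j' := by
  constructor
  · intro h
    have hn : 0 < n := by omega
    have h1 := congrArg (· / n) h
    have h2 := congrArg (· % n) h
    simp only [mul_comm _ n, Nat.mul_add_div hn, Nat.div_eq_of_lt hj, Nat.div_eq_of_lt hj',
      Nat.mul_add_mod, Nat.mod_eq_of_lt hj, Nat.mod_eq_of_lt hj', add_zero] at h1 h2
    exact ⟨h1, h2⟩
  · rintro ⟨rfl, rfl⟩; rfl

/-- Compute the adjacency matrix of a graph; the command `c` computes the entry for the vertices in the
registers `7` and `8` and writes it into register `10`. -/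
def buildAdj (c : Cmd) : Cmd :=
  .forN 7 (.forN 8 (.seq c (.store 6 (.add (.load 2 (.reg 7)) (.reg 8)) (.reg 10))))

/-- The command `c` is a black box that may use scratch registers but neither loop counters nor
arrays. Addresses are row-major with columns below `n`, so by `address_inj` writing one entry
disturbs no other. -/
theorem buildAdj_spec {k n : ℕ} {adj : Fin n → Fin n → Prop} {c : Cmd} {s : State}
    (ht : HasTables k n s) (hc2 : c.writesReg 2 = false) (hc7 : c.writesReg 7 = false)
    (hc8 : c.writesReg 8 = false) (hc : ∀ b, c.writesArr b = false)
    (hval : ∀ s' (u v : Fin n), Cmd.Frame (buildAdj c) s s' → s'.reg 7 = u.val → s'.reg 8 = v.val →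
      ((c.den s').reg 10 ≠ 0 ↔ adj u v)) :
    IsAdjMatrix n adj ((buildAdj c).den s) := by
  have := Cmd.forN_induction (x := 7) (s := s)
    (p := .forN 8 (.seq c (.store 6 (.add (.load 2 (.reg 7)) (.reg 8)) (.reg 10))))
    (fun i s' => ∀ u v : Fin n, u.val < i → (s'.arr 6 (u.val * n + v.val) ≠ 0 ↔ adj u v))
    (by simp) (by
      intro i s' hi hx hF hI
      rw [ht.size] at hi
      lift i to Fin n using hi
      have h2' : s'.reg 2 = n := (hF.reg 2 (by simp [Cmd.writesReg, hc2])).trans ht.size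
      have := Cmd.forN_induction (x := 8) (s := s')
        (p := .seq c (.store 6 (.add (.load 2 (.reg 7)) (.reg 8)) (.reg 10)))
        (fun j s'' => ∀ u v : Fin n, (u.val < i.val ∨ u = i ∧ v.val < j) →
          (s''.arr 6 (u.val * n + v.val) ≠ 0 ↔ adj u v))
        (by simpa using hI) (by
          intro j s'' hj hx2 hF2 hJ u v huv
          rw [h2'] at hj
          lift j to Fin n using hj
          have hF3 : Cmd.Frame (buildAdj c) s s'' := hF.trans hF2
            (fun y hy => ⟨hy, by
              simp only [buildAdj, Cmd.writesReg, Bool.or_eq_false_iff] at hy ⊢; exact hy.2⟩)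
            (fun b hb => ⟨hb, by simpa [buildAdj, Cmd.writesArr] using hb⟩)
          have h7 : s''.reg 7 = i.val := (hF2.reg 7 (by simp [Cmd.writesReg, hc7])).trans hx
          have hv := hval s'' i j hF3 h7 hx2
          have harr2 : (c.den s'').arr 2 i.val = i.val * n := by
            rw [Cmd.arr_den c (hc 2), hF3.arr 2 (by simp [buildAdj, Cmd.writesArr, hc]),
              ht.row i i.isLt]
          simp only [Cmd.den, Expr.eval, State.arr_setReg, State.arr_setArr, if_true,
            Cmd.reg_den c hc7, Cmd.reg_den c hc8, h7, hx2, harr2, Function.update_apply,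
            address_inj v.isLt j.isLt, Fin.val_inj]
          split_ifs with h
          · rw [h.1, h.2]; exact hv
          · rw [Cmd.arr_den c (hc 6)]
            refine hJ u v (huv.imp id fun h3 => ⟨h3.1, ?_⟩)
            have : v.val ≠ j.val := fun h4 => h ⟨h3.1, Fin.ext h4⟩
            omega)
      rw [h2'] at this
      intro u v hu
      refine this u v ?_
      rcases Nat.lt_succ_iff_lt_or_eq.1 hu with h | h
      · exact Or.inl h
      · exact Or.inr ⟨Fin.ext h, v.isLt⟩)
  intro u v
  rw [ht.size] at this
  exact this u v u.isLt

/-- Array `1` contains the array `P` from the address `1` on. -/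
def HasGrid (n : ℕ) (P : PartialGrid n) (s : State) : Prop :=
  ∀ i j : Fin n, s.arr 1 (i.val * n + j.val + 1) = cellCode (P i j)

/-- The address of a cell. -/
def cellAddr (row col : Expr) : Expr := .succ (.add (.load 2 row) col)

/-- The row of the cell with the number in register `7` in the current block. -/
def blockRow : Expr := .add (.reg 5) (.load 4 (.reg 7))

/-- The column of the cell with the number in register `7` in the current block. -/
def blockCol : Expr := .add (.reg 6) (.load 5 (.reg 7))

/-- The content of the cell with the number in register `7` in the current block. -/
def blockEntry : Expr := .load 1 (cellAddr blockRow blockCol)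

/-- Decide whether the symbol in register `8` fits into the cell with the number in register `7` of
the current block. -/
def fitsTest : Cmd :=
  .seq (find 10 9 (.eqTest (.load 1 (cellAddr (.reg 9) blockCol)) (.succ (.reg 8))))
    (.assign 10 (.add (.eqTest blockEntry (.succ (.reg 8)))
      (.sub (.eqTest blockEntry (.const 0)) (.reg 10))))

/-- The cell with the number `u` in the block with the coordinates `(b, d)`. -/
def _root_.blockCell {k n : ℕ} (hn : n = k ^ 2) (b d : Fin k) (u : Fin n) : Fin n × Fin n :=
  (blockIndex hn b ⟨u.val / k, by
    rw [Nat.div_lt_iff_lt_mul b.pos, ← sq, ← hn]; exact u.isLt⟩,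
    blockIndex hn d ⟨u.val % k, Nat.mod_lt _ b.pos⟩)

section blockCell

variable {k n : ℕ} (hn : n = k ^ 2) (b d : Fin k)

theorem _root_.blockCell_injective : Function.Injective (blockCell hn b d) := fun u v huv => by
  simp only [blockCell, Prod.mk.injEq] at huv
  have h1 := Fin.mk.inj (blockIndex_inj hn huv.1).2
  have h2 := Fin.mk.inj (blockIndex_inj hn huv.2).2
  rw [Fin.ext_iff, ← Nat.div_add_mod u.val k, ← Nat.div_add_mod v.val k, h1, h2]

theorem _root_.exists_blockCell_eq {i j : Fin n} :
    (i.val / k = b.val ∧ j.val / k = d.val) ↔ ∃ u, blockCell hn b d u = (i, j) := by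
  constructor
  · rintro ⟨hi, hj⟩
    obtain ⟨b', a, hb, ha, hia⟩ := exists_blockIndex hn i
    obtain ⟨d', c, hd, hc, hjc⟩ := exists_blockIndex hn j
    obtain rfl : b' = b := Fin.ext (hb.trans hi)
    obtain rfl : d' = d := Fin.ext (hd.trans hj)
    refine ⟨blockIndex hn a c, ?_⟩
    simp only [blockCell, blockIndex_div, blockIndex_mod, ← hia, ← hjc]
  · rintro ⟨u, hu⟩
    simp only [blockCell, Prod.mk.injEq] at hu
    rw [← hu.1, ← hu.2, blockIndex_div, blockIndex_div]
    exact ⟨rfl, rfl⟩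

/-- A matching between the cells of a block and the symbols fills the block. -/
theorem _root_.exists_isBlockFilling_of_matching {P : PartialGrid n} {σ : Fin n → Fin n}
    (hσ : Function.Injective σ)
    (hfit : ∀ u, Fits P (blockCell hn b d u).1 (blockCell hn b d u).2 (σ u)) :
    ∃ τ, IsBlockFilling k b.val d.val P τ ∧
      ∀ u, τ (blockCell hn b d u).1 (blockCell hn b d u).2 = σ u := by
  -- The matching is indexed by cell numbers and is transported to coordinates; outside the block
  -- any value will do.
  have hτ : ∀ i j : Fin n, ∃ x, ∀ u, blockCell hn b d u = (i, j) → x = σ u := fun i j => by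
    by_cases h : ∃ u, blockCell hn b d u = (i, j)
    · obtain ⟨u, hu⟩ := h
      exact ⟨σ u, fun v hv => by rw [blockCell_injective hn b d (hu.trans hv.symm)]⟩
    · exact ⟨i, fun u hu => absurd ⟨u, hu⟩ h⟩
  choose τ hτ using hτ
  refine ⟨τ, ⟨fun i j hi hj => ?_, fun i j i' j' hi hj hi' hj' hij => ?_⟩, fun u => hτ _ _ u rfl⟩
  · obtain ⟨u, hu⟩ := (exists_blockCell_eq hn b d).1 ⟨hi, hj⟩
    have := hfit u
    rwa [hu, ← hτ i j u hu] at this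
  · obtain ⟨u, hu⟩ := (exists_blockCell_eq hn b d).1 ⟨hi, hj⟩
    obtain ⟨u', hu'⟩ := (exists_blockCell_eq hn b d).1 ⟨hi', hj'⟩
    rw [hτ i j u hu, hτ i' j' u' hu'] at hij
    rw [hσ hij, hu', Prod.mk.injEq] at hu
    exact ⟨hu.1.symm, hu.2.symm⟩

theorem _root_.IsBlockFilling.hasMatching {P : PartialGrid n} {τ : Fin n → Fin n → Fin n}
    (h : IsBlockFilling k b.val d.val P τ) :
    HasMatching fun u v => Fits P (blockCell hn b d u).1 (blockCell hn b d u).2 v := by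
  have hmem := fun u => (exists_blockCell_eq hn b d).2
    ⟨u, (Prod.mk.eta (p := blockCell hn b d u)).symm⟩
  refine ⟨fun u => τ (blockCell hn b d u).1 (blockCell hn b d u).2, fun u v huv => ?_, fun u => ?_⟩
  · have := h.2 _ _ _ _ (hmem u).1 (hmem u).2 (hmem v).1 (hmem v).2 huv
    exact blockCell_injective hn b d (Prod.ext this.1 this.2)
  · exact h.1 _ _ (hmem u).1 (hmem u).2

end blockCell

section Block

variable {k n : ℕ} (hn : n = k ^ 2) {b d : Fin k} {P : PartialGrid n} {s : State}

theorem eval_blockRow (ht : HasTables k n s) (hb : s.reg 5 = b.val * k) {u : Fin n}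
    (hu : s.reg 7 = u.val) : blockRow.eval s = (blockCell hn b d u).1.val := by
  simp [blockRow, hb, hu, ht.div u u.isLt, blockCell, blockIndex]

theorem eval_blockCol (ht : HasTables k n s) (hd : s.reg 6 = d.val * k) {u : Fin n}
    (hu : s.reg 7 = u.val) : blockCol.eval s = (blockCell hn b d u).2.val := by
  simp [blockCol, hd, hu, ht.mod u u.isLt, blockCell, blockIndex]

theorem eval_cellAddr (ht : HasTables k n s) {row col : Expr} {i : Fin n} {j : ℕ}
    (hi : row.eval s = i.val) (hj : col.eval s = j) :
    (cellAddr row col).eval s = i.val * n + j + 1 := by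
  simp [cellAddr, hi, hj, ht.row i i.isLt]

theorem eval_blockEntry (ht : HasTables k n s) (hP : HasGrid n P s) (hb : s.reg 5 = b.val * k)
    (hd : s.reg 6 = d.val * k) {u : Fin n} (hu : s.reg 7 = u.val) :
    blockEntry.eval s = cellCode (P (blockCell hn b d u).1 (blockCell hn b d u).2) := by
  rw [blockEntry, Expr.eval, eval_cellAddr ht (eval_blockRow hn (d := d) ht hb hu)
    (eval_blockCol hn (b := b) ht hd hu), hP]

/-- After the search, register `10` is positive exactly if the symbol occurs in the column.
Truncated subtraction of it from the emptiness test expresses "empty and not in the column", and the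
sum with the equality test is the disjunction in `Fits`. -/
theorem fitsTest_spec (ht : HasTables k n s) (hP : HasGrid n P s) (hb : s.reg 5 = b.val * k)
    (hd : s.reg 6 = d.val * k) {u v : Fin n} (hu : s.reg 7 = u.val) (hv : s.reg 8 = v.val) :
    (fitsTest.den s).reg 10 ≠ 0 ↔ Fits P (blockCell hn b d u).1 (blockCell hn b d u).2 v := by
  have hfind := find_spec (r := 10) (x := 9)
    (e := .eqTest (.load 1 (cellAddr (.reg 9) blockCol)) (.succ (.reg 8))) (s := s)
    (by decide) (by decide) (fun i => ∀ hi : i < n, P ⟨i, hi⟩ (blockCell hn b d u).2 = some v) (by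
      intro i s' hi harr hreg hx
      rw [ht.size] at hi
      have ht' : HasTables k n s' := ⟨(hreg 2 (by decide) (by decide)).trans ht.size,
        by rw [harr]; exact ht.row, by rw [harr]; exact ht.div, by rw [harr]; exact ht.mod⟩
      have h1 := eval_cellAddr (row := .reg 9) (i := ⟨i, hi⟩) ht' hx (eval_blockCol hn (b := b)
        (d := d) ht' ((hreg 6 (by decide) (by decide)).trans hd)
        ((hreg 7 (by decide) (by decide)).trans hu))
      simp only [Expr.eval_eqTest, Expr.eval_succ, Expr.eval, h1, hreg 8 (by decide) (by decide), hv,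
        harr, hP ⟨i, hi⟩, cellCode_eq_succ]
      simp [hi])
  have hF := Cmd.frame_den (find 10 9 (.eqTest (.load 1 (cellAddr (.reg 9) blockCol))
    (.succ (.reg 8)))) s
  rw [fitsTest, Cmd.den_seq]
  generalize Cmd.den (find 10 9 (.eqTest (.load 1 (cellAddr (.reg 9) blockCol))
    (.succ (.reg 8)))) s = s₁ at hfind hF ⊢
  rw [ht.size] at hfind
  have ht₁ : HasTables k n s₁ := ht.of_frame hF rfl
  have hP₁ : HasGrid n P s₁ := by rw [HasGrid, hF.arr 1 rfl]; exact hP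
  have hentry := eval_blockEntry hn ht₁ hP₁ ((hF.reg 5 rfl).trans hb) ((hF.reg 6 rfl).trans hd)
    ((hF.reg 7 rfl).trans hu)
  have hv₁ : s₁.reg 8 = v.val := (hF.reg 8 rfl).trans hv
  simp only [Cmd.den, State.reg_setReg, if_true, Expr.eval, Expr.eval_eqTest, Expr.eval_succ, hentry,
    hv₁, cellCode_eq_succ, cellCode_eq_zero, Fits]
  by_cases h1 : P (blockCell hn b d u).1 (blockCell hn b d u).2 = some v
  · simp [h1]
  · rcases hfind with ⟨h10, hno⟩ | ⟨i, hi, hiv, h10⟩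
    · have : ∀ i', P i' (blockCell hn b d u).2 ≠ some v := fun i' hi' =>
        hno i' i'.isLt fun _ => hi'
      simp [h10, this]
    · have : ¬ ∀ i', P i' (blockCell hn b d u).2 ≠ some v := fun h => h ⟨i, hi⟩ (hiv hi)
      simp only [h1, this, if_false, h10, and_false, or_self, iff_false, not_not]
      split_ifs <;> omega

/-- Write the matching into the current block. -/
def writeBlock : Cmd := .forN 7 (.store 1 (cellAddr blockRow blockCol) (.load 7 (.reg 7)))

/-- The invariant describes the cells already written and the cells outside the block. The remaining
cells of the block need no description, since all of them get overwritten. -/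
theorem writeBlock_spec (ht : HasTables k n s) (hP : HasGrid n P s) (hb : s.reg 5 = b.val * k)
    (hd : s.reg 6 = d.val * k) {τ : Fin n → Fin n → Fin n}
    (hτ : ∀ u : Fin n, s.arr 7 u.val = (τ (blockCell hn b d u).1 (blockCell hn b d u).2).val + 1) :
    HasGrid n (fillBlock k b.val d.val P τ) (writeBlock.den s) := by
  have := Cmd.forN_induction (x := 7) (s := s)
    (p := .store 1 (cellAddr blockRow blockCol) (.load 7 (.reg 7)))
    (fun t s' => ∀ i j : Fin n,
      (∀ u : Fin n, u.val < t → blockCell hn b d u = (i, j) →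
        s'.arr 1 (i.val * n + j.val + 1) = (τ i j).val + 1) ∧
      ((∀ u, blockCell hn b d u ≠ (i, j)) → s'.arr 1 (i.val * n + j.val + 1) = cellCode (P i j)))
    (fun i j => ⟨by simp, fun _ => hP i j⟩) (by
      intro t s' hlt hx hF hI i j
      rw [ht.size] at hlt
      lift t to Fin n using hlt
      have ht' : HasTables k n s' := ht.of_frame hF rfl
      have h1 := eval_cellAddr ht' (eval_blockRow hn (d := d) ht' ((hF.reg 5 rfl).trans hb) hx)
        (eval_blockCol hn (b := b) ht' ((hF.reg 6 rfl).trans hd) hx)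
      simp only [Cmd.den, State.arr_setReg, State.arr_setArr, if_true, h1, Expr.eval, hx,
        hF.arr 7 rfl, hτ t, Function.update_apply, add_left_inj,
        address_inj j.isLt (blockCell hn b d t).2.isLt, Fin.val_inj]
      constructor
      · intro u hu huij
        split_ifs with h
        · rw [h.1, h.2]
        · refine (hI i j).1 u ?_ huij
          have : u ≠ t := by
            rintro rfl
            exact h ⟨by rw [huij], by rw [huij]⟩
          have : u.val ≠ t.val := fun h => this (Fin.ext h)
          omega
      · intro hne
        split_ifs with h
        · exact absurd (Prod.ext h.1.symm h.2.symm) (hne t)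
        · exact (hI i j).2 hne)
  rw [ht.size] at this
  intro i j
  by_cases h : ∃ u, blockCell hn b d u = (i, j)
  · obtain ⟨u, hu⟩ := h
    have hmem := (exists_blockCell_eq hn b d).2 ⟨u, hu⟩
    simp only [fillBlock, hmem, and_self, if_true]
    exact (this i j).1 u u.isLt hu
  · have hmem : ¬ (i.val / k = b.val ∧ j.val / k = d.val) := fun hm =>
      h ((exists_blockCell_eq hn b d).1 hm)
    simp only [fillBlock, hmem, if_false]
    exact (this i j).2 fun u hu => h ⟨u, hu⟩

/-- Fill the current block. -/
def blockStep : Cmd := .seq (buildAdj fitsTest) (.seq solve writeBlock)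

/-- Perfect matchings between cell numbers and symbols correspond to fillings of the block, so the
solver decides fillability. After a failure the block is still overwritten with meaningless values,
hence that alternative promises nothing about the grid. -/
theorem blockStep_spec (hn : n = k ^ 2) (ht : HasTables k n s) (hP : HasGrid n P s) (hb : s.reg 5 = b.val * k)
    (hd : s.reg 6 = d.val * k) (h4 : s.reg 4 = 0) :
    ((blockStep.den s).reg 4 ≠ 0 ∧ ¬ ∃ τ, IsBlockFilling k b.val d.val P τ) ∨
      ((blockStep.den s).reg 4 = 0 ∧ ∃ τ, IsBlockFilling k b.val d.val P τ ∧
        HasGrid n (fillBlock k b.val d.val P τ) (blockStep.den s)) := by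
  have hadj := buildAdj_spec (c := fitsTest)
    (adj := fun u v => Fits P (blockCell hn b d u).1 (blockCell hn b d u).2 v) ht rfl rfl rfl
    (fun _ => rfl) (fun s' u v hF hu hv => fitsTest_spec hn (ht.of_frame hF rfl)
      (by rw [HasGrid, hF.arr 1 rfl]; exact hP) ((hF.reg 5 rfl).trans hb) ((hF.reg 6 rfl).trans hd)
      hu hv)
  have hF := Cmd.frame_den (buildAdj fitsTest) s
  rw [blockStep, Cmd.den_seq, Cmd.den_seq]
  generalize (buildAdj fitsTest).den s = s₁ at hadj hF ⊢
  have hs := solve_spec (ht.of_frame hF rfl) hadj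
  have hF₂ := Cmd.frame_den solve s₁
  generalize solve.den s₁ = s₂ at hs hF₂ ⊢
  have hF₃ := Cmd.frame_den writeBlock s₂
  rw [hF₃.reg 4 rfl]
  rcases hs with ⟨h1, h2⟩ | ⟨h1, σ, hσ, hfit, h7⟩
  · exact Or.inl ⟨by simp [h1], fun ⟨τ, hτ⟩ => h2 (hτ.hasMatching hn)⟩
  · right
    refine ⟨h1.trans ((hF.reg 4 rfl).trans h4), ?_⟩
    obtain ⟨τ, hτ, hτσ⟩ := exists_isBlockFilling_of_matching hn b d hσ hfit
    refine ⟨τ, hτ, ?_⟩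
    have ht₁ : HasTables k n s₁ := ht.of_frame hF rfl
    refine writeBlock_spec hn (ht₁.of_frame hF₂ rfl) ?_ ((hF₂.reg 5 rfl).trans ((hF.reg 5 rfl).trans hb))
      ((hF₂.reg 6 rfl).trans ((hF.reg 6 rfl).trans hd)) fun u => by rw [h7, hτσ]
    rw [HasGrid, hF₂.arr 1 rfl, hF.arr 1 rfl]
    exact hP

end Block

end RAM

/-! ### Processing a band and a row -/

namespace RAM

/-- There is no early exit: after a failure the program runs on, and the flag must survive. The same
holds for the analogous lemmas on larger commands. -/
theorem solve_reg_four {s : State} (h : s.reg 4 ≠ 0) : (solve.den s).reg 4 ≠ 0 := by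
  have hF := Cmd.frame_den (.seq matching (find 10 9 (.eqTest (.load 7 (.reg 9)) (.const 0)))) s
  have h4 := hF.reg 4 rfl
  rw [Cmd.den_seq] at h4
  rw [solve, Cmd.den_seq, Cmd.den_seq]
  rw [Cmd.den_cond]
  split_ifs
  · rw [← h4] at h; exact h
  · simp [Cmd.den]

theorem blockStep_reg_four {s : State} (h : s.reg 4 ≠ 0) : (blockStep.den s).reg 4 ≠ 0 := by
  rw [blockStep, Cmd.den_seq, Cmd.den_seq, (Cmd.frame_den writeBlock _).reg 4 rfl]
  refine solve_reg_four ?_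
  rwa [(Cmd.frame_den (buildAdj fitsTest) s).reg 4 rfl]

/-- Fill the blocks of the band that starts at the row in register `5`. -/
def bandStep : Cmd := .forN 6 (.cond (.load 5 (.reg 6)) .skip blockStep)

theorem bandStep_reg_four {s : State} (h : s.reg 4 ≠ 0) : (bandStep.den s).reg 4 ≠ 0 :=
  Cmd.forN_induction (x := 6) (s := s) (fun _ s' => s'.reg 4 ≠ 0) (by simpa using h)
    (by
      intro i s' _ _ _ hI
      simp only [State.reg_setReg, Nat.reduceEqDiff, if_false, Cmd.den]
      split_ifs
      · exact blockStep_reg_four hI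
      · exact hI)

theorem bandStep_spec {k n : ℕ} (hn : n = k ^ 2) {b : Fin k} {P : PartialGrid n} {s : State}
    (ht : HasTables k n s) (hP : HasGrid n P s) (hb : s.reg 5 = b.val * k) (h4 : s.reg 4 = 0) :
    ((bandStep.den s).reg 4 ≠ 0 ∧ ∃ d < k, ¬ ∃ τ, IsBlockFilling k b.val d P τ) ∨
      ((bandStep.den s).reg 4 = 0 ∧ ∃ P', HasGrid n P' (bandStep.den s) ∧
        IsBandFilling k b.val k P P') := by
  have hk : 0 < k := b.pos
  have := Cmd.forN_induction (x := 6) (s := s) (p := .cond (.load 5 (.reg 6)) .skip blockStep)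
    -- Loops can only run to `n`, so the blocks are visited at the columns divisible by `k`. The
    -- number `D` of filled blocks is `j / k` rounded up, expressed by the two inequalities; at `j =
    -- n` they force `D = k`.
    (fun j s' => (s'.reg 4 ≠ 0 ∧ ∃ d < k, ¬ ∃ τ, IsBlockFilling k b.val d P τ) ∨
      (s'.reg 4 = 0 ∧ ∃ D P', j ≤ D * k ∧ D * k < j + k ∧ HasGrid n P' s' ∧
        IsBandFilling k b.val D P P'))
    (Or.inr ⟨by simpa using h4, 0, P, by simp, by simpa using hk, hP, .refl k b.val P⟩) (by
      intro j s' hj hx hF hI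
      rw [ht.size] at hj
      have ht' : HasTables k n s' := ht.of_frame hF rfl
      simp only [State.reg_setReg, Nat.reduceEqDiff, if_false, Cmd.den, Expr.eval, hx, ht'.mod j hj,
        HasGrid, State.arr_setReg]
      rcases hI with ⟨h, hd⟩ | ⟨h, D, P', hD, hD', hP', hfill⟩
      · refine Or.inl ⟨?_, hd⟩
        split_ifs
        · exact blockStep_reg_four h
        · exact h
      · by_cases hmod : j % k = 0
        · obtain ⟨d, rfl⟩ := Nat.dvd_of_mod_eq_zero hmod
          rw [mul_comm k d] at hx hj hD hD'
          obtain rfl : d = D := by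
            have h1 := Nat.le_of_mul_le_mul_right hD hk
            rw [← Nat.succ_mul] at hD'
            have h2 := Nat.lt_of_mul_lt_mul_right hD'
            omega
          have hdk : d < k := by
            rw [hn, sq] at hj
            exact Nat.lt_of_mul_lt_mul_right hj
          simp only [hmod, if_true]
          rcases blockStep_spec hn (b := b) (d := ⟨d, hdk⟩) ht' hP' ((hF.reg 5 rfl).trans hb) hx h with
            ⟨h5, h6⟩ | ⟨h5, τ, h6, h7⟩
          -- The failure, observed after `d` blocks were filled, is carried back to the band as it
          -- was at the start.
          · simp only [hfill.isBlockFilling_iff] at h6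
            exact Or.inl ⟨h5, d, hdk, h6⟩
          · refine Or.inr ⟨h5, d + 1, _, ?_, ?_, h7, hfill.fillBlock h6⟩
            · rw [mul_comm k d, Nat.succ_mul]; omega
            · rw [mul_comm k d, Nat.succ_mul]; omega
        · simp only [hmod, if_false]
          refine Or.inr ⟨h, D, P', ?_, by omega, hP', hfill⟩
          have : j ≠ D * k := by
            rintro rfl
            simp at hmod
          omega)
  rw [ht.size] at this
  rcases this with h | ⟨h, D, P', hD, hD', hP', hfill⟩
  · exact Or.inl h
  · obtain rfl : D = k := by
      rw [hn, sq] at hD hD'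
      have h1 := Nat.le_of_mul_le_mul_right hD hk
      rw [← Nat.succ_mul] at hD'
      have h2 := Nat.lt_of_mul_lt_mul_right hD'
      omega
    exact Or.inr ⟨h, P', hP', hfill⟩

/-- Find a row from the row in register `5` on in which the expression `e` stands in the column
in register `7`. -/
def findRow (e : Expr) : Cmd :=
  find 10 9 (.sub (.eqTest (.load 1 (cellAddr (.reg 9) (.reg 7))) e) (.sub (.reg 5) (.reg 9)))

/-- The equality test has value at most `1`, so subtracting the truncated difference of registers
`5` and `9` cancels it in every row before the one in register `5`. -/
theorem findRow_spec {k n : ℕ} {P : PartialGrid n} {s : State} {e : Expr} {i j x : Fin n}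
    (ht : HasTables k n s) (hP : HasGrid n P s) (h5 : s.reg 5 = i.val) (h7 : s.reg 7 = j.val)
    (he : ∀ s', s'.arr = s.arr → (∀ y, y ≠ 10 → y ≠ 9 → s'.reg y = s.reg y) →
      e.eval s' = x.val + 1) :
    (((findRow e).den s).reg 10 = 0 ∧ ¬ ∃ i', i.val ≤ i'.val ∧ P i' j = some x) ∨
      ∃ i' : Fin n, i.val ≤ i'.val ∧ P i' j = some x ∧ ((findRow e).den s).reg 10 = i'.val + 1 := by
  have := find_spec (r := 10) (x := 9) (e := .sub (.eqTest (.load 1 (cellAddr (.reg 9) (.reg 7))) e)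
    (.sub (.reg 5) (.reg 9))) (s := s) (by decide) (by decide)
    (fun t => ∀ h : t < n, i.val ≤ t ∧ P ⟨t, h⟩ j = some x) (by
      intro t s' hlt harr hreg hx
      rw [ht.size] at hlt
      have ht' : HasTables k n s' := ⟨(hreg 2 (by decide) (by decide)).trans ht.size,
        by rw [harr]; exact ht.row, by rw [harr]; exact ht.div, by rw [harr]; exact ht.mod⟩
      have h1 := eval_cellAddr (row := .reg 9) (col := .reg 7) (i := ⟨t, hlt⟩) ht' hx
        ((hreg 7 (by decide) (by decide)).trans h7)
      simp only [Expr.eval, Expr.eval_eqTest, h1, he s' harr hreg, hx,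
        hreg 5 (by decide) (by decide), h5, harr, hP ⟨t, hlt⟩ j, cellCode_eq_succ, hlt, forall_true_left]
      split_ifs with h
      · simp only [h, and_true]; omega
      · simp [h])
  rw [ht.size] at this
  rcases this with ⟨h1, h2⟩ | ⟨t, hlt, h1, h2⟩
  · exact Or.inl ⟨h1, fun ⟨i', h3, h4⟩ => h2 i' i'.isLt fun _ => ⟨h3, h4⟩⟩
  · exact Or.inr ⟨⟨t, hlt⟩, (h1 hlt).1, (h1 hlt).2, h2⟩

/-- Exchange cells within the columns so that the matching stands in the row in register `5`. -/
def exchangeRow : Cmd :=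
  .forN 7 (.seq (findRow (.load 7 (.reg 7)))
    (.seq (.store 1 (cellAddr (.pred (.reg 10)) (.reg 7)) (.load 1 (cellAddr (.reg 5) (.reg 7))))
      (.store 1 (cellAddr (.reg 5) (.reg 7)) (.load 7 (.reg 7)))))

/-- The search may return any suitable row; the column condition makes it unique, hence equal to `ι
t`. No temporary cell is needed: the old entry of row `i` moves first, and its replacement is known
from the matching. If `ι t = i`, both stores hit the same cell with the same symbol. -/
theorem exchangeRow_spec {k n : ℕ} {P : PartialGrid n} {s : State} {i : Fin n} {σ ι : Fin n → Fin n}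
    (ht : HasTables k n s) (hP : HasGrid n P s) (h5 : s.reg 5 = i.val) (hcol : ColumnCondition P)
    (h7 : ∀ u : Fin n, s.arr 7 u.val = (σ u).val + 1)
    (hι : ∀ j, i.val ≤ (ι j).val ∧ P (ι j) j = some (σ j)) :
    HasGrid n (exchange P i ι) (exchangeRow.den s) := by
  have := Cmd.forN_induction (x := 7) (s := s) (p := .seq (findRow (.load 7 (.reg 7)))
    (.seq (.store 1 (cellAddr (.pred (.reg 10)) (.reg 7)) (.load 1 (cellAddr (.reg 5) (.reg 7))))
      (.store 1 (cellAddr (.reg 5) (.reg 7)) (.load 7 (.reg 7)))))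
    (fun t s' => HasGrid n (fun r c => if c.val < t then exchange P i ι r c else P r c) s')
    (by simpa [HasGrid] using hP) (by
      intro t s' hlt hx hF hI
      rw [ht.size] at hlt
      lift t to Fin n using hlt
      have ht' : HasTables k n s' := ht.of_frame hF rfl
      have h5' : s'.reg 5 = i.val := (hF.reg 5 rfl).trans h5
      have h7' := hF.arr 7 rfl
      have hfind := findRow_spec (e := .load 7 (.reg 7)) (x := σ t) ht' hI h5' hx (by
        intro s'' harr hreg
        simp [hreg 7 (by decide) (by decide), hx, harr, h7', h7])
      have hF₂ := Cmd.frame_den (findRow (.load 7 (.reg 7))) s'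
      rw [Cmd.den_seq]
      generalize (findRow (.load 7 (.reg 7))).den s' = s'' at hfind hF₂ ⊢
      simp only [lt_self_iff_false, if_false] at hfind
      have h10 : s''.reg 10 = (ι t).val + 1 := by
        rcases hfind with ⟨_, h⟩ | ⟨i', _, h, h'⟩
        · exact absurd ⟨_, hι t⟩ h
        · rw [h', hcol i' (ι t) t (σ t) h (hι t).2]
      have ht₂ : HasTables k n s'' := ht'.of_frame hF₂ rfl
      have g5 : s''.reg 5 = i.val := (hF₂.reg 5 rfl).trans h5'
      have g7 : s''.reg 7 = t.val := (hF₂.reg 7 rfl).trans hx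
      have a1 := eval_cellAddr (row := .pred (.reg 10)) (col := .reg 7) (i := ι t) ht₂
        (by simp [h10]) g7
      have a2 := eval_cellAddr (row := .reg 5) (col := .reg 7) (i := i) ht₂ g5 g7
      -- The first store changes array `1`, whereas addresses are computed from array `2`.
      have a3 : ∀ v, (cellAddr (.reg 5) (.reg 7)).eval (s''.setArr 1 (ι t * n + t + 1) v) =
          i.val * n + t.val + 1 := fun v => by
        rw [← a2]
        simp [cellAddr, State.arr_setArr]
      have hI' : HasGrid n (fun r c => if c.val < t.val then exchange P i ι r c else P r c) s'' := by
        rw [HasGrid, hF₂.arr 1 rfl]; exact hI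
      have e7 : s''.arr 7 = s.arr 7 := (hF₂.arr 7 rfl).trans h7'
      have hit := hI' i t
      simp only [lt_self_iff_false, if_false] at hit
      intro r c
      simp only [Cmd.den, State.arr_setReg, State.arr_setArr, a1, a3, Expr.eval, a2, State.reg_setArr,
        g7, e7, Nat.reduceEqDiff, if_false, if_true, h7, Function.update_apply, hit, add_left_inj,
        address_inj c.isLt t.isLt, Fin.val_inj, hI' r c]
      by_cases hc : c = t
      · subst hc
        simp only [and_true, Nat.lt_succ_self, if_true, lt_self_iff_false, if_false, exchange]
        by_cases hr : r = i
        · simp [hr, (hι c).2, cellCode]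
        · by_cases hr2 : r = ι c
          · simp only [hr2, if_true, Equiv.swap_apply_right]
            split_ifs with h
            · rw [← h, (hι c).2]; rfl
            · rfl
          · simp [hr, hr2, Equiv.swap_apply_of_ne_of_ne hr hr2]
      · have : c.val < t.val + 1 ↔ c.val < t.val := by
          have : c.val ≠ t.val := fun h => hc (Fin.ext h)
          omega
        simp only [hc, and_false, if_false, this])
  rw [ht.size] at this
  intro r c
  refine (this r c).trans ?_
  simp

/-- Arrange the row in register `5`. -/
def rowStep : Cmd := .seq (buildAdj (findRow (.succ (.reg 8)))) (.seq solve exchangeRow)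

theorem rowStep_reg_four {s : State} (h : s.reg 4 ≠ 0) : (rowStep.den s).reg 4 ≠ 0 := by
  rw [rowStep, Cmd.den_seq, Cmd.den_seq, (Cmd.frame_den exchangeRow _).reg 4 rfl]
  refine solve_reg_four ?_
  rwa [(Cmd.frame_den (buildAdj (findRow (.succ (.reg 8)))) s).reg 4 rfl]

/-- By `IsDraft.exists_row` the matching problem for a row is always solvable, so the failure flag
cannot be raised here. -/
theorem rowStep_spec {k n b q : ℕ} (hn : n = k ^ 2) {P : PartialGrid n} {s : State} {i : Fin n}
    (ht : HasTables k n s) (hP : HasGrid n P s) (h5 : s.reg 5 = i.val) (h4 : s.reg 4 = 0)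
    (h : IsDraft k i.val q P) (hq : q = (b + 1) * k) (hb : b < k) (hbi : b * k ≤ i.val)
    (hiq : i.val < q) :
    (rowStep.den s).reg 4 = 0 ∧ ∃ P', HasGrid n P' (rowStep.den s) ∧ IsDraft k (i.val + 1) q P' ∧
      ∀ i' j, i'.val < i.val → P' i' j = P i' j := by
  have hadj := buildAdj_spec (c := findRow (.succ (.reg 8)))
    (adj := fun j x => ∃ i', i.val ≤ i'.val ∧ P i' j = some x) ht rfl rfl rfl
    (fun _ => rfl) (fun s' u v hF hu hv => by
      have := findRow_spec (e := .succ (.reg 8)) (x := v) (ht.of_frame hF rfl)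
        (by rw [HasGrid, hF.arr 1 rfl]; exact hP) ((hF.reg 5 rfl).trans h5) hu (by
          intro s'' _ hreg
          simp [hreg 8 (by decide) (by decide), hv])
      rcases this with ⟨h1, h2⟩ | ⟨i', h1, h2, h3⟩
      · simp only [h1, ne_eq, not_true_eq_false, h2]
      · simp only [h3, ne_eq, Nat.add_eq_zero_iff, one_ne_zero, and_false, not_false_eq_true, true_iff]
        exact ⟨i', h1, h2⟩)
  have hF := Cmd.frame_den (buildAdj (findRow (.succ (.reg 8)))) s
  rw [rowStep, Cmd.den_seq, Cmd.den_seq]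
  generalize (buildAdj (findRow (.succ (.reg 8)))).den s = s₁ at hadj hF ⊢
  have ht₁ : HasTables k n s₁ := ht.of_frame hF rfl
  have hs := solve_spec ht₁ hadj
  have hF₂ := Cmd.frame_den solve s₁
  generalize solve.den s₁ = s₂ at hs hF₂ ⊢
  rcases hs with ⟨_, h2⟩ | ⟨h1, σ, hσ, hfit, h7⟩
  · exact absurd (h.exists_row hn hq hb hbi hiq) h2
  · choose ι hι using hfit
    rw [(Cmd.frame_den exchangeRow s₂).reg 4 rfl]
    refine ⟨h1.trans ((hF.reg 4 rfl).trans h4), exchange P i ι, ?_,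
      IsDraft.isDraft_exchange h hq hbi hσ hι,
      fun i' j hi' => IsDraft.exchange_of_lt (fun j => (hι j).1) hi' j⟩
    refine exchangeRow_spec (ht₁.of_frame hF₂ rfl) ?_ ((hF₂.reg 5 rfl).trans ((hF.reg 5 rfl).trans h5))
      h.column h7 hι
    rw [HasGrid, hF₂.arr 1 rfl, hF.arr 1 rfl]
    exact hP

end RAM

/-! ### The completion algorithm -/

namespace RAM

/-- Compute the multiples of `n` and the squares. -/
def makeRows : Cmd :=
  .forN 5 (.seq (.store 2 (.succ (.reg 5)) (.add (.load 2 (.reg 5)) (.reg 2)))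
    (.store 3 (.succ (.reg 5)) (.add (.load 3 (.reg 5)) (.succ (.add (.reg 5) (.reg 5))))))

/-- Without multiplication, multiples arise by adding `n` repeatedly, and squares by adding the odd
numbers `2 * i + 1`. -/
theorem makeRows_spec {n : ℕ} {s : State} (h : s.reg 2 = n) (h2 : s.arr 2 0 = 0)
    (h3 : s.arr 3 0 = 0) {i : ℕ} (hi : i ≤ n) :
    (makeRows.den s).arr 2 i = i * n ∧ (makeRows.den s).arr 3 i = i * i := by
  have := Cmd.forN_induction (x := 5) (s := s)
    (p := .seq (.store 2 (.succ (.reg 5)) (.add (.load 2 (.reg 5)) (.reg 2)))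
      (.store 3 (.succ (.reg 5)) (.add (.load 3 (.reg 5)) (.succ (.add (.reg 5) (.reg 5))))))
    (fun t s' => ∀ i ≤ t, s'.arr 2 i = i * n ∧ s'.arr 3 i = i * i) (by simp [h2, h3]) (by
      intro t s' _ hx hF hI i hi
      simp only [Cmd.den, State.arr_setReg, State.arr_setArr, State.reg_setArr, Expr.eval,
        Expr.eval_succ, hx, Nat.reduceEqDiff, if_false, if_true, Function.update_apply,
        (hF.reg 2 rfl).trans h, hI t le_rfl]
      split_ifs with hit
      · subst hit
        constructor <;> ring
      · exact hI i (by omega))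
  rw [h] at this
  exact this i hi

/-- Compute the square root of `n`. -/
def makeRoot : Cmd :=
  .seq (find 10 9 (.eqTest (.load 3 (.succ (.reg 9))) (.reg 2))) (.assign 3 (.reg 10))

/-- The shift by one in `find` matches the shift in the test, so register `10` contains the root
itself. -/
theorem makeRoot_spec {k n : ℕ} (hn : n = k ^ 2) (hn0 : 0 < n) {s : State} (h : s.reg 2 = n)
    (h3 : ∀ i ≤ n, s.arr 3 i = i * i) : (makeRoot.den s).reg 3 = k := by
  have hk : 0 < k := by
    rcases Nat.eq_zero_or_pos k with rfl | hk
    · simp [hn] at hn0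
    · exact hk
  have hkn : k ≤ n := by rw [hn, sq]; exact Nat.le_mul_of_pos_left k hk
  have hfind := find_spec (r := 10) (x := 9) (e := .eqTest (.load 3 (.succ (.reg 9))) (.reg 2)) (s := s)
    (by decide) (by decide) (fun i => i + 1 = k) (by
      intro i s' hi harr hreg hx
      rw [h] at hi
      have : (i + 1) * (i + 1) = n ↔ i + 1 = k := by
        rw [hn, ← sq]
        exact Nat.pow_left_inj (by decide)
      simp [hx, harr, h3 (i + 1) hi, hreg 2 (by decide) (by decide), h, this])
  rw [makeRoot, Cmd.den_seq]
  simp only [Cmd.den_assign, State.reg_setReg, if_true, Expr.eval]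
  rw [h] at hfind
  rcases hfind with ⟨_, h2⟩ | ⟨i, _, h1, h2⟩
  · exact absurd (by omega) (h2 (k - 1) (by omega))
  · rw [h2, h1]

/-- Compute the quotients and remainders modulo `k`. -/
def makeDiv : Cmd :=
  .seq (.assign 6 (.const 0)) (.seq (.assign 7 (.const 0))
    (.forN 5 (.seq (.store 4 (.reg 5) (.reg 6)) (.seq (.store 5 (.reg 5) (.reg 7))
      (.cond (.eqTest (.succ (.reg 7)) (.reg 3))
        (.seq (.assign 7 (.const 0)) (.assign 6 (.succ (.reg 6)))) (.assign 7 (.succ (.reg 7))))))))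

/-- Registers `6` and `7` count quotient and remainder; when the remainder would reach `k`, it is
reset and the quotient advances. -/
theorem makeDiv_spec {k : ℕ} (hk : 0 < k) {s : State} (h3 : s.reg 3 = k) {i : ℕ}
    (hi : i < s.reg 2) :
    (makeDiv.den s).arr 4 i = i / k ∧ (makeDiv.den s).arr 5 i = i % k := by
  have := Cmd.forN_induction (x := 5) (s := (s.setReg 6 0).setReg 7 0)
    (p := .seq (.store 4 (.reg 5) (.reg 6)) (.seq (.store 5 (.reg 5) (.reg 7))
      (.cond (.eqTest (.succ (.reg 7)) (.reg 3))
        (.seq (.assign 7 (.const 0)) (.assign 6 (.succ (.reg 6)))) (.assign 7 (.succ (.reg 7))))))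
    (fun t s' => s'.reg 6 = t / k ∧ s'.reg 7 = t % k ∧
      ∀ i < t, s'.arr 4 i = i / k ∧ s'.arr 5 i = i % k) (by simp) (by
      intro t s' _ hx hF hI
      obtain ⟨h6, h7, hI⟩ := hI
      have hmod : ∀ {i}, i < t + 1 → i ≠ t → i < t := fun h1 h2 => by omega
      by_cases hc : t % k + 1 = k
      · have hdvd : k ∣ t + 1 := (Nat.dvd_iff_mod_eq_zero).2 (by
          rw [Nat.add_mod, ← Nat.add_mod_mod, Nat.mod_mod]; simp [hc])
        simp only [Cmd.den, State.arr_setReg, State.arr_setArr, State.reg_setArr, State.reg_setReg,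
          Expr.eval, Expr.eval_succ, Expr.eval_eqTest, hx, Nat.reduceEqDiff, if_false, if_true,
          Function.update_apply, h6, h7, (hF.reg 3 rfl).trans h3, hc, one_ne_zero]
        refine ⟨?_, ?_, fun i hi => ?_⟩
        · simp [Nat.succ_div, hdvd]
        · simp [Nat.mod_eq_zero_of_dvd hdvd]
        · split_ifs with hit
          · simp [hit]
          · exact hI i (hmod hi hit)
      · have hlt := Nat.mod_lt t hk
        have hmod1 : (t + 1) % k = t % k + 1 := by
          rw [Nat.add_mod, Nat.mod_eq_of_lt (show 1 < k by omega), Nat.mod_eq_of_lt (by omega)]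
        have hdvd : ¬ k ∣ t + 1 := fun h => by
          have := Nat.mod_eq_zero_of_dvd h
          omega
        simp only [Cmd.den, State.arr_setReg, State.arr_setArr, State.reg_setArr, State.reg_setReg,
          Expr.eval, Expr.eval_succ, Expr.eval_eqTest, hx, Nat.reduceEqDiff, if_false, if_true,
          Function.update_apply, h6, h7, (hF.reg 3 rfl).trans h3, hc]
        refine ⟨?_, ?_, fun i hi => ?_⟩
        · simp [Nat.succ_div, hdvd]
        · simp [hmod1]
        · split_ifs with hit
          · simp [hit]
          · exact hI i (hmod hi hit))
  exact this.2.2 i hi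

/-- Copy the input into array `1`. -/
def copyGrid : Cmd :=
  .forN 5 (.forN 6 (.store 1 (cellAddr (.reg 5) (.reg 6)) (.load 0 (cellAddr (.reg 5) (.reg 6)))))

/-- The grid starts at address `1` in both arrays: address `0` holds the order in the input and the
verdict in the answer. -/
theorem copyGrid_spec {k n : ℕ} {P : PartialGrid n} {s : State} (ht : HasTables k n s)
    (hP : ∀ i j : Fin n, s.arr 0 (i.val * n + j.val + 1) = cellCode (P i j)) :
    HasGrid n P (copyGrid.den s) := by
  have := Cmd.forN_induction (x := 5) (s := s)
    (p := .forN 6 (.store 1 (cellAddr (.reg 5) (.reg 6)) (.load 0 (cellAddr (.reg 5) (.reg 6)))))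
    (fun t s' => ∀ i j : Fin n, i.val < t → s'.arr 1 (i.val * n + j.val + 1) = cellCode (P i j))
    (by simp) (by
      intro t s' hlt hx hF hI
      rw [ht.size] at hlt
      lift t to Fin n using hlt
      have ht' : HasTables k n s' := ht.of_frame hF rfl
      have := Cmd.forN_induction (x := 6) (s := s')
        (p := .store 1 (cellAddr (.reg 5) (.reg 6)) (.load 0 (cellAddr (.reg 5) (.reg 6))))
        (fun t' s'' => ∀ i j : Fin n, (i.val < t.val ∨ i = t ∧ j.val < t') →
          s''.arr 1 (i.val * n + j.val + 1) = cellCode (P i j))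
        (by simpa using hI) (by
          intro t' s'' hlt' hx' hF' hI' i j hij
          rw [ht'.size] at hlt'
          lift t' to Fin n using hlt'
          have ha := eval_cellAddr (row := .reg 5) (col := .reg 6) (ht'.of_frame hF' rfl)
            ((hF'.reg 5 rfl).trans hx) hx'
          simp only [Cmd.den, State.arr_setReg, State.arr_setArr, if_true, Expr.eval, ha,
            (hF'.arr 0 rfl).trans (hF.arr 0 rfl), hP, Function.update_apply, add_left_inj,
            address_inj j.isLt t'.isLt, Fin.val_inj]
          split_ifs with h
          · rw [h.1, h.2]
          · refine hI' i j (hij.imp id fun h3 => ⟨h3.1, ?_⟩)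
            have : j.val ≠ t'.val := fun h4 => h ⟨h3.1, Fin.ext h4⟩
            omega)
      rw [ht'.size] at this
      intro i j hi
      refine this i j ?_
      rcases Nat.lt_succ_iff_lt_or_eq.1 hi with h | h
      · exact Or.inl h
      · exact Or.inr ⟨Fin.ext h, j.isLt⟩)
  rw [ht.size] at this
  exact fun i j => this i j i.isLt

/-- Prepare the tables and the working copy of the input. -/
def setup : Cmd := .seq makeRows (.seq makeRoot (.seq makeDiv copyGrid))

theorem setup_spec {k n : ℕ} (hn : n = k ^ 2) (hn0 : 0 < n) {P : PartialGrid n} {s : State}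
    (h : s.reg 2 = n) (h2 : s.arr 2 0 = 0) (h3 : s.arr 3 0 = 0)
    (hP : ∀ i j : Fin n, s.arr 0 (i.val * n + j.val + 1) = cellCode (P i j)) :
    HasTables k n (setup.den s) ∧ HasGrid n P (setup.den s) := by
  have hk : 0 < k := by
    rcases Nat.eq_zero_or_pos k with rfl | hk
    · simp [hn] at hn0
    · exact hk
  have h₁ := fun {i} => makeRows_spec (i := i) h h2 h3
  have hF₁ := Cmd.frame_den makeRows s
  rw [setup, Cmd.den_seq, Cmd.den_seq, Cmd.den_seq]
  generalize makeRows.den s = s₁ at h₁ hF₁ ⊢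
  have h₂ := makeRoot_spec hn hn0 ((hF₁.reg 2 rfl).trans h) fun i hi => (h₁ hi).2
  have hF₂ := Cmd.frame_den makeRoot s₁
  generalize makeRoot.den s₁ = s₂ at h₂ hF₂ ⊢
  have hs₂ : s₂.reg 2 = n := (hF₂.reg 2 rfl).trans ((hF₁.reg 2 rfl).trans h)
  have h₃ := fun {i} => makeDiv_spec hk h₂ (i := i)
  have hF₃ := Cmd.frame_den makeDiv s₂
  generalize makeDiv.den s₂ = s₃ at h₃ hF₃ ⊢
  have ht : HasTables k n s₃ := by
    refine ⟨(hF₃.reg 2 rfl).trans hs₂, fun i hi => ?_, fun i hi => ?_, fun i hi => ?_⟩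
    · rw [hF₃.arr 2 rfl, hF₂.arr 2 rfl]; exact (h₁ hi.le).1
    · exact (h₃ (hs₂.symm ▸ hi)).1
    · exact (h₃ (hs₂.symm ▸ hi)).2
  refine ⟨ht.of_frame (Cmd.frame_den copyGrid s₃) rfl, copyGrid_spec ht ?_⟩
  rw [hF₃.arr 0 rfl, hF₂.arr 0 rfl, hF₁.arr 0 rfl]
  exact hP

/-- Fill the band that starts at the row in register `5`, if any, and arrange this row unless it is
filled in the input. -/
def step : Cmd :=
  .seq (.cond (.load 5 (.reg 5)) .skip bandStep)
    (.cond (.load 0 (cellAddr (.reg 5) (.const 0))) .skip rowStep)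

theorem cond_skip_reg_four {e : Expr} {p : Cmd} (hp : ∀ s : State, s.reg 4 ≠ 0 → (p.den s).reg 4 ≠ 0)
    {s : State} (h : s.reg 4 ≠ 0) : ((Cmd.cond e .skip p).den s).reg 4 ≠ 0 := by
  rw [Cmd.den_cond]
  split_ifs
  · exact hp s h
  · exact h

theorem step_reg_four {s : State} (h : s.reg 4 ≠ 0) : (step.den s).reg 4 ≠ 0 := by
  rw [step, Cmd.den_seq]
  exact cond_skip_reg_four (fun _ => rowStep_reg_four)
    (cond_skip_reg_four (fun _ => bandStep_reg_four) h)

/-- The working array before the step for row `i`. -/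
def Progress (k m i : ℕ) {n : ℕ} (R : PartialGrid n) (s : State) : Prop :=
  ∃ P, HasGrid n P s ∧ Extends P R ∧
    IsDraft k (max i m) (if i % k = 0 then max i m else max m ((i / k + 1) * k)) P

/-- Before row `i`, the arranged rows are those before `max i m`. At the start of a band nothing
further is filled; inside a band, the whole band is filled already and its later rows wait to be
arranged. -/
theorem step_spec {k m n : ℕ} (hn : n = k ^ 2) {R : PartialGrid n} (hR : IsSudokuRectangle k m R)
    {s : State} {i : Fin n} (ht : HasTables k n s) (h5 : s.reg 5 = i.val) (h4 : s.reg 4 = 0)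
    (h0 : ∀ i j : Fin n, s.arr 0 (i.val * n + j.val + 1) = cellCode (R i j))
    (hI : Progress k m i R s) :
    ((step.den s).reg 4 ≠ 0 ∧ ¬ ∃ S : FullGrid n, IsCompletion k R S) ∨
      ((step.den s).reg 4 = 0 ∧ Progress k m (i.val + 1) R (step.den s)) := by
  obtain ⟨P, hP, hext, hdraft⟩ := hI
  obtain ⟨b, a, hb, ha, hia⟩ := exists_blockIndex hn i
  have hk : 0 < k := b.pos
  have hival : i.val = b.val * k + a.val := by rw [hia]; rfl
  have hmul : (b.val + 1) * k = b.val * k + k := by ring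
  have hak := a.isLt
  have hext_trans : ∀ {P' : PartialGrid n}, (∀ i j, R i j ≠ none → P i j = P' i j) →
      Extends P' R := fun h i j hij => (hext i j hij).trans (h i j hij)
  have band : (((Cmd.cond (.load 5 (.reg 5)) .skip bandStep).den s).reg 4 ≠ 0 ∧
        ¬ ∃ S : FullGrid n, IsCompletion k R S) ∨
      (((Cmd.cond (.load 5 (.reg 5)) .skip bandStep).den s).reg 4 = 0 ∧
        ∃ P', HasGrid n P' ((Cmd.cond (.load 5 (.reg 5)) .skip bandStep).den s) ∧ Extends P' R ∧
          IsDraft k (max i m) (max m ((b.val + 1) * k)) P') := by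
    rw [Cmd.den_cond]
    simp only [Expr.eval, h5, ht.mod i i.isLt]
    by_cases hmod : i.val % k = 0
    · simp only [hmod, if_true] at hdraft ⊢
      have hib : i.val = b.val * k := by omega
      rcases bandStep_spec hn (b := b) ht hP (h5.trans hib) h4 with ⟨h1, d, hd, h2⟩ | ⟨h1, P', h2, h3⟩
      · refine Or.inl ⟨h1, fun ⟨S, hS⟩ => h2 ?_⟩
        -- If `i ≤ m`, nothing has been added yet, so the array is `R` and a completion would fill
        -- the failing block. If `m ≤ i`, the filled part consists of complete bands and no block
        -- can fail.
        rcases le_total i.val m with him | him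
        · have hPR : P = R := by
            funext i' j
            by_cases hi' : i'.val < m
            · exact (hext i' j ((hR.2 i' j).2 hi')).symm
            · have h3 : P i' j = none := by
                by_contra h3
                have := (hdraft.filled i' j).1 h3
                omega
              have h4 : R i' j = none := by
                by_contra h4
                exact hi' ((hR.2 i' j).1 h4)
              rw [h3, h4]
          rw [hPR]
          exact ⟨S, hS.isBlockFilling b.val d⟩
        · rw [max_eq_left him, hib] at hdraft
          exact hdraft.exists_isBlockFilling hn b.isLt hd
      · obtain ⟨h4, h5⟩ := h3.isDraft hn hdraft (by omega)
        refine Or.inr ⟨h1, P', h2, hext_trans fun i j hij => h5 i j ?_, ?_⟩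
        · rw [← hext i j hij]; exact hij
        · rwa [show max m ((b.val + 1) * k) = max (max i.val m) ((b.val + 1) * k) by omega]
    · simp only [hmod, if_false] at hdraft ⊢
      refine Or.inr ⟨h4, P, hP, hext, ?_⟩
      rwa [hb]
  have hF := Cmd.frame_den (.cond (.load 5 (.reg 5)) .skip bandStep) s
  rw [step, Cmd.den_seq]
  generalize (Cmd.cond (.load 5 (.reg 5)) .skip bandStep).den s = s₁ at band hF ⊢
  have ht₁ : HasTables k n s₁ := ht.of_frame hF rfl
  have hnpos : 0 < n := (Nat.zero_le _).trans_lt i.isLt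
  -- The number `m` is not part of the input. Whether row `i` is given is read off from its first
  -- cell.
  have hentry : (Expr.load 0 (cellAddr (.reg 5) (.const 0))).eval s₁ = cellCode (R i ⟨0, hnpos⟩) := by
    rw [Expr.eval, eval_cellAddr (row := .reg 5) (col := .const 0) ht₁ ((hF.reg 5 rfl).trans h5) (j := 0) rfl, hF.arr 0 rfl]
    exact h0 i ⟨0, hnpos⟩
  -- The next row either starts a new band, exactly where the current one ends, or belongs to the
  -- same band; these are the two cases of `Progress`.
  have hquot : ((i.val + 1) % k = 0 ∧ (b.val + 1) * k = i.val + 1) ∨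
      ((i.val + 1) % k ≠ 0 ∧ (i.val + 1) / k = b.val) := by
    by_cases hlast : a.val + 1 = k
    · left
      have : (b.val + 1) * k = i.val + 1 := by omega
      exact ⟨by rw [← this, Nat.mul_mod_left], this⟩
    · right
      rw [hival, add_assoc, mul_comm, Nat.mul_add_mod, Nat.mul_add_div hk,
        Nat.mod_eq_of_lt (show a.val + 1 < k by omega), Nat.div_eq_of_lt (by omega)]
      simp
  have hnext : ∀ {P' : PartialGrid n},
      IsDraft k (max (i.val + 1) m) (max m ((b.val + 1) * k)) P' →
      IsDraft k (max (i.val + 1) m) (if (i.val + 1) % k = 0 then max (i.val + 1) m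
        else max m (((i.val + 1) / k + 1) * k)) P' := fun h => by
    rcases hquot with ⟨h1, h2⟩ | ⟨h1, h2⟩
    · rw [h2, max_comm m] at h
      rwa [if_pos h1]
    · rwa [if_neg h1, h2]
  rw [Cmd.den_cond, hentry]
  simp only [cellCode_eq_zero]
  rcases band with ⟨h1, h2⟩ | ⟨h1, P', hP', hext', hdraft'⟩
  · left
    refine ⟨?_, h2⟩
    split_ifs
    · exact rowStep_reg_four h1
    · exact h1
  · right
    by_cases him : i.val < m
    · have : R i ⟨0, hnpos⟩ ≠ none := (hR.2 _ _).2 him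
      simp only [this, if_false]
      refine ⟨h1, P', hP', hext', hnext ?_⟩
      rwa [show max (i.val + 1) m = max i.val m by omega]
    · have : R i ⟨0, hnpos⟩ = none := by
        by_contra h
        exact him ((hR.2 _ _).1 h)
      simp only [this, if_true]
      rw [max_eq_left (by omega), max_eq_right (by omega)] at hdraft'
      obtain ⟨h6, P'', h7, h8, h9⟩ := rowStep_spec hn ht₁ hP' ((hF.reg 5 rfl).trans h5) h1 hdraft' rfl
        b.isLt (by omega) (by omega)
      refine ⟨h6, P'', h7, fun i' j hij => ?_, hnext ?_⟩
      · rw [hext' i' j hij, h9]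
        have := (hR.2 i' j).1 hij
        omega
      · rwa [max_eq_left (by omega), max_eq_right (by omega)]

/-- Write the answer. -/
def finish : Cmd :=
  .cond (.reg 4) (.seq (.assign 1 (.const 1)) (.store 1 (.const 0) (.const 0)))
    (.seq (.assign 1 (.reg 0)) (.store 1 (.const 0) (.const 1)))

/-- The completion algorithm, with `n` in register `2`. -/
def complete : Cmd := .seq setup (.seq (.forN 5 step) finish)

theorem output_eq {n : ℕ} {S : FullGrid n} {s : State} (h1 : s.reg 1 = n * n + 1)
    (h0 : s.arr 1 0 = 1) (hS : HasGrid n S.toPartial s) : output s = answerWords (some S) := by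
  refine List.ext_getElem (by simp [output, h1, answerWords, gridWords]) fun c hc hc' => ?_
  cases c with
  | zero => simp [output, answerWords, h0]
  | succ c =>
    have hc2 : c < n * n := by simpa [output, h1] using hc
    have := hS (⟨c, hc2⟩ : Fin (n * n)).divNat (⟨c, hc2⟩ : Fin (n * n)).modNat
    simp only [Fin.coe_divNat, Fin.coe_modNat, Nat.div_add_mod'] at this
    simpa [output, answerWords, gridWords] using this

/-- After `n` steps, a multiple of `k`, the invariant says that all rows are filled and arranged.
The answer has one word for the verdict and `n * n` for the cells, as many as the input, so its
length is copied from register `0`. -/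
theorem complete_spec {k m n : ℕ} (hn : n = k ^ 2) (hm : m < n) {R : PartialGrid n}
    (hR : IsSudokuRectangle k m R) {s : State} (h2 : s.reg 2 = n)
    (h0 : s.reg 0 = n * n + 1) (h4 : s.reg 4 = 0) (ha2 : s.arr 2 0 = 0) (ha3 : s.arr 3 0 = 0)
    (ha0 : ∀ i j : Fin n, s.arr 0 (i.val * n + j.val + 1) = cellCode (R i j)) :
    ∃ ans : Option (FullGrid n), output (complete.den s) = answerWords ans ∧
      IsCorrectAnswer k R ans := by
  obtain ⟨ht, hG⟩ := setup_spec hn (by omega) h2 ha2 ha3 ha0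
  have hF := Cmd.frame_den setup s
  rw [complete, Cmd.den_seq, Cmd.den_seq]
  generalize setup.den s = s₁ at ht hG hF ⊢
  have hloop := Cmd.forN_induction (x := 5) (s := s₁) (p := step)
    (fun i s' => (s'.reg 4 ≠ 0 ∧ ¬ ∃ S : FullGrid n, IsCompletion k R S) ∨
      (s'.reg 4 = 0 ∧ Progress k m i R s'))
    (Or.inr ⟨(hF.reg 4 rfl).trans h4, R, hG, fun _ _ _ => rfl, by simpa using hR.isDraft⟩) (by
      intro i s' hi hx hF' hI
      rw [ht.size] at hi
      rcases hI with ⟨h, h'⟩ | ⟨h, h'⟩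
      · exact Or.inl ⟨by simpa using step_reg_four h, h'⟩
      · have := step_spec hn hR (i := ⟨i, hi⟩) (ht.of_frame hF' rfl) hx h (by
          rw [hF'.arr 0 rfl, hF.arr 0 rfl]; exact ha0) h'
        exact this)
  have hF' := Cmd.frame_den (.forN 5 step) s₁
  rw [ht.size] at hloop
  generalize (Cmd.forN 5 step).den s₁ = s₂ at hloop hF' ⊢
  have g0 : s₂.reg 0 = n * n + 1 := (hF'.reg 0 rfl).trans ((hF.reg 0 rfl).trans h0)
  rcases hloop with ⟨h, hno⟩ | ⟨h, P, hP, hext, hdraft⟩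
  · refine ⟨none, ?_, hno⟩
    simp [finish, Cmd.den, h, output, answerWords, State.arr_setArr, List.range_succ]
  · have hmod : n % k = 0 := by rw [hn, sq, Nat.mul_mod_left]
    rw [if_pos hmod, max_eq_left hm.le] at hdraft
    choose S hS using fun i j : Fin n => hdraft.exists_eq_some i.isLt j
    have hSP : FullGrid.toPartial S = P := funext fun i => funext fun j => (hS i j).symm
    refine ⟨some S, output_eq ?_ ?_ fun i j => ?_, ?_, ?_⟩
    · simp [finish, Cmd.den, h, g0]
    · simp [finish, Cmd.den, h, State.arr_setArr]
    · rw [hSP, ← hP i j]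
      simp [finish, Cmd.den, h, State.arr_setArr]
    · rw [IsSudokuSquare, hSP]
      exact ⟨fun i j j' x => hdraft.row i j j' x i.isLt, hdraft.column, hdraft.block⟩
    · rw [hSP]; exact hext

theorem complete_wf : complete.wf = true := by decide

/-- The completion algorithm as a program. -/
def completeProg : Prog := .seq (.assign 2 (.load 0 (.const 0))) complete.toProg

theorem arr_zero_inputState {n : ℕ} (R : PartialGrid n) (i j : Fin n) :
    (inputState (inputWords R)).arr 0 (i.val * n + j.val + 1) = cellCode (R i j) := by
  have hlt : i.val * n + j.val < n * n := by
    have h1 := j.isLt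
    have h2 : (i.val + 1) * n ≤ n * n := Nat.mul_le_mul_right n i.isLt
    linarith
  have hdiv : (⟨i.val * n + j.val, hlt⟩ : Fin (n * n)).divNat = i ∧
      (⟨i.val * n + j.val, hlt⟩ : Fin (n * n)).modNat = j := by
    have := (address_inj (i := (i.val * n + j.val) / n) (j := (i.val * n + j.val) % n)
      (Nat.mod_lt _ (by have := j.isLt; omega)) j.isLt).1 (Nat.div_add_mod' _ _)
    exact ⟨Fin.ext this.1, Fin.ext this.2⟩
  simp [inputState, inputWords, gridWords, List.getD_eq_getElem?_getD, hlt, hdiv]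

theorem run_completeProg {k m n : ℕ} {R : PartialGrid n} (hn : n = k ^ 2) (hm : m < n)
    (hR : IsSudokuRectangle k m R) : ∃ (t : ℕ) (ans : Option (FullGrid n)),
      t ≤ (complete.time + 3).eval n ∧ Run completeProg (inputWords R) t (answerWords ans) ∧
        IsCorrectAnswer k R ans := by
  -- Loading `n` into register `2` takes three steps, which accounts for the `3` in the time bound.
  have e₁ := Exec.assign (inputState (inputWords R)) 2 (.load 0 (.const 0))
  have hval : (Expr.load 0 (.const 0)).eval (inputState (inputWords R)) = n := by
    simp [inputState, inputWords]
  rw [hval] at e₁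
  obtain ⟨t, ht, e₂⟩ := Cmd.exec_toProg complete_wf ((inputState (inputWords R)).setReg 2 n)
  obtain ⟨ans, hans, hcorrect⟩ := complete_spec hn hm hR
    (s := (inputState (inputWords R)).setReg 2 n) (by simp)
    (by simp [inputState, inputWords, gridWords]) (by simp [inputState]) (by simp [inputState])
    (by simp [inputState]) fun i j => arr_zero_inputState R i j
  refine ⟨_, ans, ?_, ⟨_, .seq e₁ e₂, hans⟩, hcorrect⟩
  simp only [State.reg_setReg, if_true] at ht
  simp only [Polynomial.eval_add, Polynomial.eval_ofNat, Expr.cost]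
  omega

end RAM

theorem theorem6 :
    (∃ (A : RAM.Prog) (p : Polynomial ℕ),
      ∀ (k n m : ℕ) (R : PartialGrid n), n = k ^ 2 → m < n → IsSudokuRectangle k m R →
        ∃ (t : ℕ) (ans : Option (FullGrid n)),
          t ≤ p.eval n ∧ RAM.Run A (inputWords R) t (answerWords ans) ∧
            IsCorrectAnswer k R ans) ∧
    (∀ (k n l r : ℕ) (R : PartialGrid n), n = k ^ 2 → l < k → r < k →
      IsSudokuRectangle k (l * k + r) R →
        ((∃ S : FullGrid n, IsCompletion k R S) ↔
          ∀ d : Fin k, HasPerfectMatchingOneTo (k - r) (FirstStageAdj k l R d))) :=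
  ⟨⟨RAM.completeProg, RAM.Cmd.time RAM.complete + 3, fun _ _ _ _ hn hm hR =>
    RAM.run_completeProg hn hm hR⟩, fun _ _ _ _ _ hn hl hr hR => exists_isCompletion_iff hn hl hr hR⟩
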